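/- **Bipartitions.** Let $n$ be even. A sequence of $d$ bipartitions $(X_{j,0},X_{j,1})$ of a set $X$ of size $n$, each with two classes of size $n/2$, is an $(n,d,\alpha,\beta)$-sequence if $|X_{j,\ell}\cap X_{j',\ell'}|\le(\frac14+\alpha)n$ for all $j\ne j'$ and $\ell,\ell'\in\{0,1\}$, and if for any two distinct $x,y\in X$ at most $(\frac12+\beta)d$ of the bipartitions have $x,y$ in the same class. **Construction.** Let $s\ge 400$ be even and $p=2^{-s}$. Put $n_0=4^{s+8}$, $n_r=2^{\lfloor n_{r-1}/200\rfloor}$ and $\alpha_r=1/(8n_0\cdots n_{r-1})$ for $1\le r\le s$, and $d_r=n_0\prod_{j=1}^{r}(n_j/2)$ for $0\le r\le s$. Start from $K_{n_0,n_0}$ with all edges in one color. In step $r=1,\dots,s$ we have an edge-colored complete bipartite graph in which each of the $2^{r-1}$ colors forms a $d_{r-1}$-regular graph. Replace each vertex $x$ by a set $X$ of $n_r$ new vertices; with each pair of a vertex $x$ and a neighbor $y$ of it associate a bipartition $(X_{y,0},X_{y,1})$ of $X$ such that, for each $x$ and each color $i$, the bipartitions associated with the neighbors $y$ of $x$ in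 color $i$ form an $(n_r,d_{r-1},\alpha_r,\frac1{16})$-sequence. Replace each edge $xy$ of color $i$ by complete bipartite graphs in a new color $i_1$ between $X_{y,0},Y_{x,0}$ and between $X_{y,1},Y_{x,1}$, and in a new color $i_2$ between $X_{y,0},Y_{x,1}$ and between $X_{y,1},Y_{x,0}$. After $s$ steps replace every vertex by $b\ge1$ vertices (each edge becoming a complete bipartite graph of the same color). The result $\mathcal G_s^*$ is a $K_{N,N}$ whose edges are colored with $2^s$ colors, each color class being a bipartite graph of density $p$. For $0\le r\le s$ let $\mathcal X_r$ be the partition of $V(\mathcal G_s^*)$ whose parts correspond to the vertices present after step $r$. **Notions.** For a graph on a vertex set $V$, let $d(A,B)$ be the number of pairs $(a,b)\in A\times B$ with $ab$ an edge, divided by $|A||B|$. A pair $(A,B)$ is $\varepsilon$-regular if $|d(A,B)-d(A',B')|\le\varepsilon$ for all $A'\subseteq A$, $B'\subseteq B$ with $|A'|\ge\varepsilon|A|$, $|B'|\ge\varepsilon|B|$. A partition $\mathcal Z$ of $V$ (not necessarily equitable) is $\varepsilon$-regular if $\sum|Z||Z'|\le\varepsilon|V|^2$, the sum being over the pairs $(Z,Z')\in\mathcal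 Z^2$ that are not $\varepsilon$-regular. $\mathcal Z\cap\mathcal X$ denotes the common refinement. For partitions $\mathcal Q,\mathcal P$ of $V$, write $\mathcal Q\preceq_\gamma\mathcal P$ if the parts $Q\in\mathcal Q$ for which no $P\in\mathcal P$ satisfies $|Q\setminus P|\le\gamma|Q|$ have total size at most $\gamma|V|$. Let $\mathrm{twr}(0)=1$, $\mathrm{twr}(x+1)=2^{\mathrm{twr}(x)}$. **Theorem.** There is an absolute constant $c>0$ such that the following holds for every even $s\ge400$, $p=2^{-s}$, and every $\mathcal G_s^*$ as above. Let $p^{4/7}\le\delta\le2^{-66}$, let $\mathcal Z$ be a partition of $V(\mathcal G_s^*)$, and suppose that one can change the colors (among the $2^s$ colors) of at most $\delta N^2$ edges of $\mathcal G_s^*$ so that afterwards $\mathcal Z$ is a $p^5$-regular partition of at least $\sqrt\delta\cdot2^s$ of the $2^s$ color classes, regarded as graphs on $V(\mathcal G_s^*)$. Then $$\mathcal Z\cap\mathcal X_0\preceq_\gamma\mathcal X_s\quad\text{with }\gamma=128\,\delta^{1/4},$$ and $$|\mathcal Z|\ge\mathrm{twr}\big(\lfloor c\log_2(1/p)\rfloor\big).$$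 -/

import Mathlib

open Finset
open scoped Classical

namespace SparseReg

noncomputable section

/-! ### Sequences of bipartitions -/

/-- A bipartition of `Fin n` is a map `Fin n → Bool`, whose fibres over `false` and `true` are the
classes number `0` and `1`. The bipartitions `B j`, `j ∈ I`, form an `(n, d, α, β)`-sequence:
there are `d` of them, each is equitable (`n` is even), and the sequence is `α`-orthogonal
and `β`-balanced. -/
structure IsBipartitionSequence {J : Type} (I : Finset J) {n : ℕ} (B : J → Fin n → Bool)
    (d : ℕ) (α β : ℝ) : Prop where
  card_eq : #I = d
  even : Even n
  equitable : ∀ j ∈ I, ∀ l : Bool, #{a | B j a = l} = n / 2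
  orthogonal : ∀ j ∈ I, ∀ j' ∈ I, j ≠ j' → ∀ l l' : Bool,
    (#{a | B j a = l ∧ B j' a = l'} : ℝ) ≤ (1 / 4 + α) * n
  balanced : ∀ a a' : Fin n, a ≠ a' → (#{j ∈ I | B j a = B j a'} : ℝ) ≤ (1 / 2 + β) * d

/-! ### The parameters of the construction -/

/-- `n₀ = 4 ^ (s + 8)` and `n_{r+1} = 2 ^ ⌊n_r / 200⌋`. -/
def partSize (s : ℕ) : ℕ → ℕ
  | 0 => 4 ^ (s + 8)
  | r + 1 => 2 ^ (partSize s r / 200)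

/-- `d_r = n₀ (n₁ / 2) ⋯ (n_r / 2)`. -/
def degreeParam (s r : ℕ) : ℕ :=
  partSize s 0 * ∏ j ∈ Icc 1 r, partSize s j / 2

/-- `α_r = 1 / (8 n₀ ⋯ n_{r-1})`. -/
def orthParam (s r : ℕ) : ℝ :=
  1 / (8 * ∏ i ∈ range r, (partSize s i : ℝ))

/-! ### The iterated multicolored modified blow-up of `K_{n₀,n₀}` -/

/-- The vertices on one side of the `r`-th bipartite graph: a vertex of the graph number `r + 1` is
a pair of a vertex `x` of the graph number `r` (`Fin.init`) and an element of the set of size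
`n_{r+1}` by which `x` is replaced (the last coordinate). -/
abbrev Vtx (s r : ℕ) : Type := (i : Fin (r + 1)) → Fin (partSize s i)

/-- The edge coloring of the `r`-th complete bipartite graph, with the `2 ^ r` colors
`Fin r → Bool`. The bipartition of the set replacing the left vertex `x` that is associated with
the right vertex `y` is `left r x y`, and the bipartition of the set replacing `y` that is
associated with `x` is `right r y x`. An edge of color `i` is replaced by edges whose color is `i`
followed by `false` (between the classes of equal number), or `i` followed by `true`
(between the classes of different number). -/
def coloring (s : ℕ) (left right : (r : ℕ) → Vtx s r → Vtx s r → Fin (partSize s (r + 1)) → Bool) :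
    (r : ℕ) → Vtx s r → Vtx s r → (Fin r → Bool)
  | 0, _, _ => Fin.elim0
  | r + 1, x, y =>
    Fin.snoc (α := fun _ => Bool) (coloring s left right r (Fin.init x) (Fin.init y))
      (xor (left r (Fin.init x) (Fin.init y) (x (Fin.last (r + 1))))
        (right r (Fin.init y) (Fin.init x) (y (Fin.last (r + 1)))))

/-- The choices made in `s` successive multicolored modified blow-ups of `K_{n₀,n₀}`: in step
`r + 1`, for every vertex and every color, the bipartitions that are associated with the neighbors
of that vertex in that color form an `(n_{r+1}, d_r, α_{r+1}, 1/16)`-sequence. -/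
structure Construction (s : ℕ) where
  left : (r : ℕ) → Vtx s r → Vtx s r → Fin (partSize s (r + 1)) → Bool
  right : (r : ℕ) → Vtx s r → Vtx s r → Fin (partSize s (r + 1)) → Bool
  left_seq : ∀ r < s, ∀ (x : Vtx s r) (i : Fin r → Bool),
    IsBipartitionSequence ({y | coloring s left right r x y = i} : Finset (Vtx s r)) (left r x)
      (degreeParam s r) (orthParam s (r + 1)) (1 / 16)
  right_seq : ∀ r < s, ∀ (y : Vtx s r) (i : Fin r → Bool),
    IsBipartitionSequence ({x | coloring s left right r x y = i} : Finset (Vtx s r)) (right r y)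
      (degreeParam s r) (orthParam s (r + 1)) (1 / 16)

/-- One side of the final graph, the blow-up in which each vertex is replaced by `b` vertices. -/
abbrev Side (s b : ℕ) : Type := Vtx s s × Fin b

/-- The vertex set of the final graph. -/
abbrev Vertex (s b : ℕ) : Type := Side s b ⊕ Side s b

/-- The edge coloring of the complete bipartite graph `K_{N,N}` on `Vertex s b`. -/
def Construction.finalColoring {s : ℕ} (K : Construction s) (b : ℕ) (u v : Side s b) :
    Fin s → Bool :=
  coloring s K.left K.right s u.1 v.1

/-- The bipartite graph formed by the edges of color `i`. -/
def colorGraph {A B C : Type} (c : A → B → C) (i : C) : SimpleGraph (A ⊕ B) :=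
  SimpleGraph.fromRel fun v w => ∃ a b, v = Sum.inl a ∧ w = Sum.inr b ∧ c a b = i

/-- The vertex of the `r`-th graph from which a vertex of the final graph stems. -/
def ancestor (s b r : ℕ) (h : r ≤ s) : Vertex s b → Vtx s r ⊕ Vtx s r :=
  Sum.map (fun u i => u.1 ⟨i, by omega⟩) (fun u i => u.1 ⟨i, by omega⟩)

/-- The partition `X_r` of the vertex set of the final graph. -/
def clusters (s b r : ℕ) (h : r ≤ s) : Finpartition (univ : Finset (Vertex s b)) :=
  Finpartition.ofSetoid (Setoid.ker (ancestor s b r h))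

/-! ### Regular partitions and approximate refinements -/

/-- The pair `(A, B)` is `ε`-regular in `G`. -/
def IsRegularPair {V : Type} (G : SimpleGraph V) (ε : ℝ) (A B : Finset V) : Prop :=
  ∀ A' ⊆ A, ∀ B' ⊆ B, ε * #A ≤ #A' → ε * #B ≤ #B' →
    |(G.edgeDensity A B : ℝ) - (G.edgeDensity A' B' : ℝ)| ≤ ε

/-- The (not necessarily equitable) vertex partition `Z` is `ε`-regular. -/
def IsRegularPartition {V : Type} [Fintype V] [DecidableEq V] (G : SimpleGraph V) (ε : ℝ)
    (Z : Finpartition (univ : Finset V)) : Prop :=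
  ∑ P ∈ Z.parts ×ˢ Z.parts with ¬ IsRegularPair G ε P.1 P.2, (#P.1 : ℝ) * #P.2
    ≤ ε * (Fintype.card V : ℝ) ^ 2

/-- `Q ⪯_β P`: the parts of `Q` that are not `β`-contained in a part of `P` have total size at
most `β` times the number of elements. -/
def ApproxRefines {V : Type} [Fintype V] [DecidableEq V] (β : ℝ) (Q P : Finpartition (univ : Finset V)) : Prop :=
  ∑ S ∈ Q.parts with ¬ ∃ T ∈ P.parts, (#(S \ T) : ℝ) ≤ β * #S, (#S : ℝ)
    ≤ β * (Fintype.card V : ℝ)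

/-- The tower of `x` exponents. -/
def twr : ℕ → ℕ
  | 0 => 1
  | x + 1 => 2 ^ twr x

end

end SparseReg

namespace SparseReg

/-! ### Restriction of vertices to earlier levels -/

/-! Put g = δ^{1/4}, γ = 128g, and call the sets Z ∩ X, with Z a part of the regular partition and X
a cluster of level 0, pieces. From each piece a chain of cells is followed downwards, always into
the largest child cell. The quantity controlled is `mass`: the total size of the pieces on one side
that lose more than a γ-fraction before level R. It vanishes at level 0, and `mass_step` shows that
if it is at most γN for one side at level R, it is at most γN for the other side at level R + 1;
`masses_le` alternates the two sides up to level s.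

For the step, suppose that many pieces Q on the left lose more than γ|Q| by level R + 1, while most
of the right side lies in cores: large parts of pieces, each inside one cluster of level R. Let C be
the greedy cell of Q at a level r ≤ R and ℓ the number of its vertices outside the next greedy cell.
Balancedness (`card_splitting`) implies that, for each color i, at least a sixth of the clusters
joined to C in the first r bits of i have bipartitions cutting C into two classes of size at least
ℓ/16. If (Q, T) is a regular pair for the new color i and the core T lies in such a cluster, the
edges of color i cannot avoid the pairs of classes in which bit r of the original color is wrong
(`split_pair`). So a proportion of order ℓ/|C| of the edges of new color i between C and T were
recolored, the old color first differing from i in bit r (`wrong_lower`). The first differing bit is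
unique, so these edges are distinct for different pieces, colors and levels, and the losses ℓ may be
added over the levels (`sum_levels`).

There are at least g²/p regular colors and the bad pieces have total size at least 64gN, so more
than g⁴N² = δN² edges were recolored, a contradiction, provided that the errors are negligible.
These are edges at vertices outside the cores, edges that lost color i, and irregular pairs. The
first needs a mixing bound for each color (`edgeCount_le`), proved by a second moment from the small
codegrees that orthogonality gives.

Finally, the parts of X_s have only b vertices, so a partition that nearly refines X_s has about as
many parts as X_s has. Dividing by the 2n₀ clusters of level 0 leaves a multiple of n_s, which is of
tower size (`twr_le_card_parts`). -/

/-- The vertex of the `t`-th graph from which a vertex of the `r`-th graph stems. -/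
def res {s r : ℕ} (t : ℕ) (h : t ≤ r) (x : Vtx s r) : Vtx s t := fun i => x ⟨i, by omega⟩

theorem res_res {s r t u : ℕ} (h : t ≤ r) (h' : u ≤ t) (x : Vtx s r) :
    res u h' (res t h x) = res u (h'.trans h) x := rfl

/-- A vertex of the graph number `r + 1` as a pair. -/
def snocEquiv (s r : ℕ) : Vtx s r × Fin (partSize s (r + 1)) ≃ Vtx s (r + 1) where
  toFun q := Fin.snoc (α := fun i : Fin (r + 2) => Fin (partSize s i)) q.1 q.2
  invFun x := (Fin.init x, x (Fin.last (r + 1)))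
  left_inv q := by
    ext1
    · exact Fin.init_snoc (α := fun i : Fin (r + 2) => Fin (partSize s i)) q.2 q.1
    · exact Fin.snoc_last (α := fun i : Fin (r + 2) => Fin (partSize s i)) q.2 q.1
  right_inv x := Fin.snoc_init_self (α := fun i : Fin (r + 2) => Fin (partSize s i)) x

theorem init_snocEquiv {s r : ℕ} (q : Vtx s r × Fin (partSize s (r + 1))) :
    (Fin.init (snocEquiv s r q) : Vtx s r) = q.1 :=
  congrArg Prod.fst ((snocEquiv s r).left_inv q)

theorem snocEquiv_last {s r : ℕ} (q : Vtx s r × Fin (partSize s (r + 1))) :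
    snocEquiv s r q (Fin.last (r + 1)) = q.2 :=
  congrArg Prod.snd ((snocEquiv s r).left_inv q)

/-- Vertices of the graph number `r + 1` are counted by their predecessors. -/
theorem card_filter_succ {s r : ℕ} (S : Vtx s (r + 1) → Prop) (P : Vtx s r → Prop)
    (R : Vtx s r → Fin (partSize s (r + 1)) → Prop) [DecidablePred S] [DecidablePred P]
    [∀ x, DecidablePred (R x)]
    (hS : ∀ x, S x ↔ P (Fin.init x) ∧ R (Fin.init x) (x (Fin.last (r + 1)))) :
    #{x : Vtx s (r + 1) | S x} = ∑ x : Vtx s r with P x, #{a | R x a} := by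
  rw [← Finset.card_sigma]
  symm
  refine Finset.card_bij (fun q _ => snocEquiv s r (q.1, q.2)) ?_ ?_ ?_
  · rintro ⟨x, a⟩ h
    simp only [mem_sigma, mem_filter, mem_univ, true_and, hS] at h ⊢
    rw [init_snocEquiv, snocEquiv_last]
    exact h
  · rintro ⟨x, a⟩ _ ⟨y, c⟩ _ h
    have := (snocEquiv s r).injective h
    simp only [Prod.mk.injEq] at this
    obtain ⟨rfl, rfl⟩ := this
    rfl
  · intro x hx
    refine ⟨⟨Fin.init x, x (Fin.last (r + 1))⟩, ?_, (snocEquiv s r).right_inv x⟩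
    simpa [hS] using hx

theorem card_vtx (s r : ℕ) : Fintype.card (Vtx s r) = ∏ i ∈ range (r + 1), partSize s i := by
  rw [Fintype.card_pi]
  simp only [Fintype.card_fin]
  exact Fin.prod_univ_eq_prod_range (fun i => partSize s i) (r + 1)

theorem partSize_pos (s r : ℕ) : 0 < partSize s r := by
  cases r <;> simp [partSize]

theorem card_vtx_succ (s r : ℕ) :
    Fintype.card (Vtx s (r + 1)) = Fintype.card (Vtx s r) * partSize s (r + 1) := by
  rw [card_vtx, card_vtx, prod_range_succ]

theorem card_vtx_pos (s r : ℕ) : 0 < Fintype.card (Vtx s r) := by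
  rw [card_vtx]; exact prod_pos fun i _ => partSize_pos s i

/-! ### The coloring -/

namespace Construction

variable {s : ℕ} (K : Construction s)

/-- The coloring of the graph number `r`. -/
def col (r : ℕ) (x y : Vtx s r) : Fin r → Bool := coloring s K.left K.right r x y

theorem col_succ_last (r : ℕ) (x y : Vtx s (r + 1)) :
    K.col (r + 1) x y (Fin.last r) =
      xor (K.left r (Fin.init x) (Fin.init y) (x (Fin.last (r + 1))))
        (K.right r (Fin.init y) (Fin.init x) (y (Fin.last (r + 1)))) := by
  simp only [col, coloring, Fin.snoc_last]

theorem col_succ_castSucc (r : ℕ) (x y : Vtx s (r + 1)) (k : Fin r) :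
    K.col (r + 1) x y k.castSucc = K.col r (Fin.init x) (Fin.init y) k := by
  simp only [col, coloring, Fin.snoc_castSucc]

theorem col_succ_eq_iff (r : ℕ) (x y : Vtx s (r + 1)) (i : Fin (r + 1) → Bool) :
    K.col (r + 1) x y = i ↔ K.col r (Fin.init x) (Fin.init y) = Fin.init i ∧
      xor (K.left r (Fin.init x) (Fin.init y) (x (Fin.last (r + 1))))
        (K.right r (Fin.init y) (Fin.init x) (y (Fin.last (r + 1)))) = i (Fin.last r) := by
  rw [← col_succ_last]
  constructor
  · rintro rfl
    exact ⟨funext fun k => (K.col_succ_castSucc r x y k).symm, rfl⟩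
  · rintro ⟨h1, h2⟩
    funext k
    refine Fin.lastCases h2 (fun j => ?_) k
    rw [col_succ_castSucc, h1]; rfl

/-- The first `t` bits of a color. -/
def _root_.SparseReg.cut {r : ℕ} (t : ℕ) (h : t ≤ r) (i : Fin r → Bool) : Fin t → Bool :=
  fun k => i ⟨k, by omega⟩

/-- Each step only appends one bit to a color, so colors between ancestors are prefixes. This is
what makes the first bit in which two colors differ tell the level of a recolored edge. -/
theorem col_res {r t : ℕ} (h : t ≤ r) (x y : Vtx s r) :
    K.col t (res t h x) (res t h y) = cut t h (K.col r x y) := by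
  induction r, h using Nat.le_induction with
  | base => rfl
  | succ r h ih =>
    rw [← res_res (Nat.le_succ r) h x, ← res_res (Nat.le_succ r) h y, ih]
    funext k
    exact (K.col_succ_castSucc r x y ⟨k, by omega⟩).symm

/-- Exchanging the two sides. -/
def swap : Construction s where
  left := K.right
  right := K.left
  left_seq r hr x i := by
    have h : ∀ r (x y : Vtx s r), coloring s K.right K.left r x y = coloring s K.left K.right r y x := by
      intro r
      induction r with
      | zero => intro x y; rfl
      | succ r ih => intro x y; simp only [coloring, ih, Bool.xor_comm]
    simp only [h]; exact K.right_seq r hr x i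
  right_seq r hr x i := by
    have h : ∀ r (x y : Vtx s r), coloring s K.right K.left r x y = coloring s K.left K.right r y x := by
      intro r
      induction r with
      | zero => intro x y; rfl
      | succ r ih => intro x y; simp only [coloring, ih, Bool.xor_comm]
    simp only [h]; exact K.left_seq r hr x i

theorem swap_col (r : ℕ) (x y : Vtx s r) : K.swap.col r x y = K.col r y x := by
  induction r with
  | zero => rfl
  | succ r ih =>
    rw [col_succ_eq_iff, ih, swap]
    refine ⟨funext fun k => (K.col_succ_castSucc r y x k).symm, ?_⟩
    rw [col_succ_last, Bool.xor_comm]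

/-! ### Degrees and codegrees -/

/-- Equitability: once the class on the left is fixed, the new bit selects exactly one of the two
halves on the right. Iterated, this makes all degrees below exact. -/
theorem card_right_xor {r : ℕ} (hr : r < s) (x y : Vtx s r) (c l : Bool) :
    2 * #{a | xor c (K.right r y x a) = l} = partSize s (r + 1) := by
  have h := K.right_seq r hr y (K.col r x y)
  have h1 := h.equitable x (mem_filter.2 ⟨mem_univ _, rfl⟩) (xor c l)
  have h2 : ({a | xor c (K.right r y x a) = l} : Finset (Fin (partSize s (r + 1)))) =
      ({a | K.right r y x a = xor c l} : Finset _) := by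
    ext a
    simp only [mem_filter, mem_univ, true_and]
    cases c <;> cases l <;> cases K.right r y x a <;> simp
  rw [h2, h1]
  obtain ⟨k, hk⟩ := h.even
  omega

/-- Every vertex of `X` sends the right number of edges of color `i` to `Y`. -/
theorem card_nbr_in_cluster {r t : ℕ} (hrt : r ≤ t) (ht : t ≤ s) (x : Vtx s t) (Y : Vtx s r)
    (i : Fin t → Bool) (hY : K.col r (res r hrt x) Y = cut r hrt i) :
    2 ^ (t - r) * #{y : Vtx s t | res r hrt y = Y ∧ K.col t x y = i} * Fintype.card (Vtx s r) =
      Fintype.card (Vtx s t) := by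
  induction t, hrt using Nat.le_induction with
  | base =>
    have : ({y : Vtx s r | res r le_rfl y = Y ∧ K.col r x y = i} : Finset _) = {Y} := by
      ext y
      simp only [mem_filter, mem_univ, true_and, mem_singleton]
      constructor
      · rintro ⟨h, _⟩; exact h
      · rintro rfl; exact ⟨rfl, hY⟩
    simp [this]
  | succ t hrt ih =>
    have hc := card_filter_succ
      (fun y : Vtx s (t + 1) => res r (hrt.trans (Nat.le_succ t)) y = Y ∧ K.col (t + 1) x y = i)
      (fun y => res r hrt y = Y ∧ K.col t (Fin.init x) y = Fin.init i)
      (fun y a => xor (K.left t (Fin.init x) y (x (Fin.last (t + 1))))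
        (K.right t y (Fin.init x) a) = i (Fin.last t))
      (fun y => by rw [col_succ_eq_iff, ← and_assoc]; rfl)
    have ih' := ih (by omega) (Fin.init x) (Fin.init i) hY
    have hsum : 2 * ∑ y : Vtx s t with (res r hrt y = Y ∧ K.col t (Fin.init x) y = Fin.init i),
        #{a | xor (K.left t (Fin.init x) y (x (Fin.last (t + 1))))
          (K.right t y (Fin.init x) a) = i (Fin.last t)} =
        #{y : Vtx s t | res r hrt y = Y ∧ K.col t (Fin.init x) y = Fin.init i} *
          partSize s (t + 1) := by
      rw [mul_sum, sum_congr rfl fun y _ => K.card_right_xor (by omega) (Fin.init x) y _ _,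
        sum_const, smul_eq_mul]
    rw [hc, show t + 1 - r = (t - r) + 1 by omega, pow_succ, mul_assoc (2 ^ (t - r)), hsum,
      card_vtx_succ, ← ih']
    ring

theorem card_nbr (x : Vtx s s) (i : Fin s → Bool) :
    2 ^ s * #{y : Vtx s s | K.col s x y = i} = Fintype.card (Vtx s s) := by
  have h : ∀ t (ht : t ≤ s) (x : Vtx s t) (i : Fin t → Bool),
      2 ^ t * #{y : Vtx s t | K.col t x y = i} = Fintype.card (Vtx s t) := by
    intro t
    induction t with
    | zero =>
      intro _ x i
      rw [filter_true_of_mem fun y _ => Subsingleton.elim _ _]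
      simp
    | succ t ih =>
      intro ht x i
      have hc := card_filter_succ (fun y : Vtx s (t + 1) => K.col (t + 1) x y = i)
        (fun y => K.col t (Fin.init x) y = Fin.init i)
        (fun y a => xor (K.left t (Fin.init x) y (x (Fin.last (t + 1))))
          (K.right t y (Fin.init x) a) = i (Fin.last t))
        (fun y => by rw [col_succ_eq_iff])
      have hsum : 2 * ∑ y : Vtx s t with K.col t (Fin.init x) y = Fin.init i,
          #{a | xor (K.left t (Fin.init x) y (x (Fin.last (t + 1))))
            (K.right t y (Fin.init x) a) = i (Fin.last t)} =
          #{y : Vtx s t | K.col t (Fin.init x) y = Fin.init i} * partSize s (t + 1) := by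
        rw [mul_sum, sum_congr rfl fun y _ => K.card_right_xor (by omega) (Fin.init x) y _ _,
          sum_const, smul_eq_mul]
      rw [hc, pow_succ, mul_assoc, hsum, card_vtx_succ, ← ih (by omega) (Fin.init x) (Fin.init i)]
      ring
  exact h s le_rfl x i

theorem card_left_pair {r : ℕ} (hr : r < s) (x y y' : Vtx s r) (hy : y ≠ y')
    (hc : K.col r x y = K.col r x y') (c c' l : Bool) :
    (#{a | xor (K.left r x y a) c = l ∧ xor (K.left r x y' a) c' = l} : ℝ) ≤
      (1 / 4 + orthParam s (r + 1)) * partSize s (r + 1) := by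
  have h := (K.left_seq r hr x (K.col r x y)).orthogonal y (mem_filter.2 ⟨mem_univ _, rfl⟩) y'
    (mem_filter.2 ⟨mem_univ _, hc.symm⟩) hy (xor l c) (xor l c')
  refine le_trans (le_of_eq ?_) h
  congr 2
  ext a
  simp only [mem_filter, mem_univ, true_and]
  cases c <;> cases c' <;> cases l <;> cases K.left r x y a <;> cases K.left r x y' a <;> simp

/-- Since `y` and `y'` differ in coordinate 0, their ancestors differ at every level. Hence each
step attaches two distinct bipartitions to a common neighbor, and orthogonality leaves a fraction of
at most 1/4 + α. -/
theorem card_common_nbr {t : ℕ} (ht : t ≤ s) (y y' : Vtx s t) (hy : y 0 ≠ y' 0)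
    (i : Fin t → Bool) :
    (#{x : Vtx s t | K.col t x y = i ∧ K.col t x y' = i} : ℝ) ≤
      (∏ r ∈ range t, (1 / 4 + orthParam s (r + 1))) * Fintype.card (Vtx s t) := by
  induction t with
  | zero =>
    simp only [range_zero, prod_empty, one_mul, Nat.cast_le]
    exact card_le_univ _
  | succ t ih =>
    have hc := card_filter_succ
      (fun x : Vtx s (t + 1) => K.col (t + 1) x y = i ∧ K.col (t + 1) x y' = i)
      (fun x => K.col t x (Fin.init y) = Fin.init i ∧ K.col t x (Fin.init y') = Fin.init i)
      (fun x a => xor (K.left t x (Fin.init y) a)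
          (K.right t (Fin.init y) x (y (Fin.last (t + 1)))) = i (Fin.last t) ∧
        xor (K.left t x (Fin.init y') a)
          (K.right t (Fin.init y') x (y' (Fin.last (t + 1)))) = i (Fin.last t))
      (fun x => by rw [col_succ_eq_iff, col_succ_eq_iff]; tauto)
    have hy' : (Fin.init y : Vtx s t) ≠ Fin.init y' := fun h => hy (congrFun h 0)
    have ih' := ih (by omega) (Fin.init y) (Fin.init y') hy (Fin.init i)
    have h0 : 0 ≤ 1 / 4 + orthParam s (t + 1) := by
      unfold orthParam; positivity
    rw [hc, Nat.cast_sum]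
    refine (sum_le_sum fun x hx => K.card_left_pair (by omega) x _ _ hy' ?_ _ _ _).trans ?_
    · simp only [mem_filter] at hx
      rw [hx.2.1, hx.2.2]
    · rw [sum_const, nsmul_eq_mul, prod_range_succ, card_vtx_succ]
      push_cast
      nlinarith [mul_le_mul_of_nonneg_right ih'
        (mul_nonneg h0 (Nat.cast_nonneg (α := ℝ) (partSize s (t + 1))))]

end Construction

/-- The 2^r colors are equally frequent at every vertex. The construction is needed only to know
that the n_j are even, so that the halves in `degreeParam` are exact. -/
theorem degreeParam_mul {s r : ℕ} (K : Construction s) (hr : r < s) :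
    2 ^ r * degreeParam s r = Fintype.card (Vtx s r) := by
  have he : ∀ j < s, Even (partSize s (j + 1)) := fun j hj =>
    (K.left_seq j hj (fun i => ⟨0, partSize_pos s i⟩) (fun _ => false)).even
  induction r with
  | zero => simp [degreeParam]
  | succ r ih =>
    have h2 : 2 * (partSize s (r + 1) / 2) = partSize s (r + 1) :=
      Nat.mul_div_cancel' (he r (by omega)).two_dvd
    have h1 : degreeParam s (r + 1) = degreeParam s r * (partSize s (r + 1) / 2) := by
      unfold degreeParam
      rw [← Finset.insert_Icc_right_eq_Icc_add_one (by omega), prod_insert (by simp)]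
      ring
    rw [card_vtx_succ, ← ih (by omega), h1, pow_succ]
    nth_rewrite 2 [← h2]
    ring

/-! ### Balanced sequences split every spread-out weight -/

theorem sum_sq_classes {n : ℕ} (B : Fin n → Bool) (w : Fin n → ℝ) :
    ∑ c : Bool, (∑ a with B a = c, w a) ^ 2 = ∑ a, ∑ a', if B a = B a' then w a * w a' else 0 := by
  rw [← sum_fiberwise univ B]
  refine sum_congr rfl fun c _ => ?_
  rw [sq, sum_mul]
  refine sum_congr rfl fun a ha => ?_
  rw [mem_filter] at ha
  rw [← sum_filter, mul_sum]
  refine sum_congr ?_ fun _ _ => rfl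
  ext a'
  simp [ha.2, eq_comm]

/-- Sum over j the products of the weights of the two classes. Balancedness bounds the weight of
pairs in a common class, so with L the total weight and l = L - w a₀ the sum is at least (7/32)dLl.
Each product is at most Ll, and at most Ll/16 if some class is lighter than l/16. -/
theorem card_splitting {J : Type} {S : Finset J} {n d : ℕ} {B : J → Fin n → Bool} {α : ℝ}
    (h : IsBipartitionSequence S B d α (1 / 16)) (w : Fin n → ℝ) (hw : ∀ a, 0 ≤ w a)
    (a₀ : Fin n) (hmax : ∀ a, w a ≤ w a₀) :
    (d : ℝ) / 6 ≤ #{j ∈ S | ∀ c, (∑ a, w a - w a₀) / 16 ≤ ∑ a with B j a = c, w a} := by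
  set L := ∑ a, w a with hL
  set l := L - w a₀ with hl
  set T : Finset J := {j ∈ S | ∀ c, l / 16 ≤ ∑ a with B j a = c, w a} with hT
  have hlL : l ≤ L := by linarith [hw a₀]
  have hl0 : 0 ≤ l := by
    have := single_le_sum (f := w) (fun a _ => hw a) (mem_univ a₀)
    linarith
  rcases (mul_nonneg (hl0.trans hlL) hl0).eq_or_lt with h0 | hpos
  · have hl0' : l = 0 := by nlinarith
    have : T = S := by
      rw [hT, filter_true_of_mem]
      intro j _ c
      rw [hl0', zero_div]
      exact sum_nonneg fun a _ => hw a
    rw [this, h.card_eq]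
    linarith [Nat.cast_nonneg (α := ℝ) d]
  set G : J → Bool → ℝ := fun j c => ∑ a with B j a = c, w a with hG
  have hG0 : ∀ j c, 0 ≤ G j c := fun j c => sum_nonneg fun a _ => hw a
  have hGL : ∀ j, G j true + G j false = L := fun j => by
    have := sum_fiberwise univ (B j) w
    rw [Fintype.sum_bool] at this
    exact this
  have hsq : ∀ j, 2 * (G j true * G j false) =
      L ^ 2 - ∑ a, ∑ a', if B j a = B j a' then w a * w a' else 0 := fun j => by
    rw [← sum_sq_classes, Fintype.sum_bool, ← hGL j]; ring
  -- Off the diagonal the coefficient is 1/2 + 1/16 = 9/16; a diagonal pair is always together,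
  -- which costs 7/16 more.
  have hpair : ∀ a a', ∑ j ∈ S, (if B j a = B j a' then w a * w a' else 0) ≤
      9 / 16 * d * (w a * w a') + if a = a' then 7 / 16 * d * (w a * w a') else 0 := by
    intro a a'
    rw [← sum_filter, sum_const, nsmul_eq_mul]
    have hww := mul_nonneg (hw a) (hw a')
    split_ifs with haa
    · have : (#{j ∈ S | B j a = B j a'} : ℝ) ≤ d := by
        rw [← h.card_eq]; exact_mod_cast card_filter_le _ _
      nlinarith
    · have := h.balanced a a' haa
      nlinarith
  have hw2 : ∑ a, w a * w a ≤ w a₀ * L := by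
    rw [hL, mul_sum]
    exact sum_le_sum fun a _ => mul_le_mul_of_nonneg_right (hmax a) (hw a)
  have hsum : ∑ j ∈ S, ∑ a, ∑ a', (if B j a = B j a' then w a * w a' else 0) ≤
      9 / 16 * d * L ^ 2 + 7 / 16 * d * (w a₀ * L) := by
    rw [sum_comm]
    simp_rw [sum_comm (s := S)]
    refine (sum_le_sum fun a _ => sum_le_sum fun a' _ => hpair a a').trans ?_
    simp_rw [sum_add_distrib, sum_ite_eq, mem_univ, if_true, ← mul_sum, ← sum_mul]
    rw [← hL, ← sq]
    gcongr
  have hlow : 7 / 32 * d * (L * l) ≤ ∑ j ∈ S, G j true * G j false := by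
    have : 2 * ∑ j ∈ S, G j true * G j false =
        d * L ^ 2 - ∑ j ∈ S, ∑ a, ∑ a', (if B j a = B j a' then w a * w a' else 0) := by
      rw [mul_sum, sum_congr rfl fun j _ => hsq j, sum_sub_distrib, sum_const, h.card_eq,
        nsmul_eq_mul]
    nlinarith
  -- The class that misses the heaviest point has weight at most l; the other has weight at most L.
  have hsmall : ∀ j c, c ≠ B j a₀ → G j c ≤ l := by
    intro j c hc
    rw [hl, hL, ← sum_erase_eq_sub (mem_univ a₀)]
    refine sum_le_sum_of_subset_of_nonneg ?_ fun a _ _ => hw a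
    intro a ha
    rw [mem_filter] at ha
    rw [mem_erase]
    refine ⟨?_, mem_univ a⟩
    rintro rfl
    exact hc ha.2.symm
  have hf1 : ∀ j, G j true * G j false ≤ L * l := by
    intro j
    have h1 := hGL j
    have h2 := hG0 j true
    have h3 := hG0 j false
    cases hb : B j a₀
    · have := hsmall j true (by simp [hb])
      nlinarith
    · have := hsmall j false (by simp [hb])
      nlinarith
  have hf2 : ∀ j ∈ S \ T, G j true * G j false ≤ L * l / 16 := by
    intro j hj
    rw [mem_sdiff, hT, mem_filter, not_and] at hj
    have h1 := hGL j
    have h2 := hG0 j true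
    have h3 := hG0 j false
    have := hj.2 hj.1
    push Not at this
    obtain ⟨c, hc⟩ := this
    change G j c < l / 16 at hc
    cases c <;> nlinarith
  have hTS : T ⊆ S := filter_subset _ _
  have hup : ∑ j ∈ S, G j true * G j false ≤ #T * (L * l) + (d - #T) * (L * l / 16) := by
    rw [← sum_sdiff hTS, add_comm]
    refine add_le_add ((sum_le_sum fun j _ => hf1 j).trans_eq ?_)
      ((sum_le_sum hf2).trans_eq ?_)
    · rw [sum_const, nsmul_eq_mul]
    · rw [sum_const, nsmul_eq_mul, cast_card_sdiff hTS, h.card_eq]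
  -- Solving 7d/32 ≤ t + (d - t)/16 for t gives t ≥ d/6.
  have : (7 / 32 * d : ℝ) * (L * l) ≤ (#T + (d - #T) / 16) * (L * l) := by linarith
  have := le_of_mul_le_mul_right this hpos
  linarith

/-! ### Edge counts in the final graph -/

/-- The number of edges of color `i` between `A` and `B`. -/
def edgeCount {U V C : Type} [DecidableEq C] (c : U → V → C) (i : C) (A : Finset U) (B : Finset V) : ℕ :=
  #{e ∈ A ×ˢ B | c e.1 e.2 = i}

theorem edgeCount_eq_sum {U V C : Type} [DecidableEq C] (c : U → V → C) (i : C) (A : Finset U) (B : Finset V) :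
    edgeCount c i A B = ∑ u ∈ A, #{v ∈ B | c u v = i} := by
  rw [edgeCount, card_filter, sum_product]
  exact sum_congr rfl fun u _ => (card_filter _ _).symm

theorem card_filter_fst {U : Type} [Fintype U] (b : ℕ) (P : U → Prop) [DecidablePred P] :
    (#{x : U × Fin b | P x.1} : ℝ) = #{u | P u} * b := by
  rw [← Nat.cast_mul, Nat.cast_inj]
  have : (univ.filter fun x : U × Fin b => P x.1) = (univ.filter P) ×ˢ univ := by
    ext x
    simp
  rw [this, card_product, card_univ, Fintype.card_fin]

theorem card_side (s b : ℕ) : Fintype.card (Side s b) = Fintype.card (Vtx s s) * b := by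
  simp [Side]

theorem edgeCount_neighbors {s : ℕ} (K : Construction s) (b : ℕ) (i : Fin s → Bool)
    (u : Side s b) :
    (#{v : Side s b | K.finalColoring b u v = i} : ℝ) =
      1 / 2 ^ s * Fintype.card (Side s b) := by
  have h := K.card_nbr u.1 i
  have h3 : (#{v : Side s b | K.finalColoring b u v = i} : ℝ) =
      #{x : Vtx s s | K.col s u.1 x = i} * b :=
    card_filter_fst b (fun x : Vtx s s => K.col s u.1 x = i)
  rw [h3, card_side, ← h]
  push_cast
  field_simp

theorem edgeCount_neighbors' {s : ℕ} (K : Construction s) (b : ℕ) (i : Fin s → Bool)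
    (v : Side s b) :
    (#{u : Side s b | K.finalColoring b u v = i} : ℝ) =
      1 / 2 ^ s * Fintype.card (Side s b) := by
  rw [← edgeCount_neighbors K.swap b i v]
  congr 2
  ext u
  rw [mem_filter, mem_filter]
  change _ ∧ K.col s _ _ = _ ↔ _ ∧ K.swap.col s _ _ = _
  rw [K.swap_col]

/-! ### Codegrees and one-sided mixing of a color class -/

theorem partSize_zero (s : ℕ) : partSize s 0 = 4 ^ (s + 8) := rfl

theorem orthParam_le (s r : ℕ) : orthParam s (r + 1) ≤ 1 / (8 * partSize s 0) := by
  unfold orthParam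
  have h0 : (0 : ℝ) < partSize s 0 := by exact_mod_cast partSize_pos s 0
  refine one_div_le_one_div_of_le (by positivity) ?_
  gcongr
  rw [prod_range_succ']
  refine le_mul_of_one_le_left h0.le ?_
  rw [← Nat.cast_prod]
  exact_mod_cast prod_pos fun i _ => partSize_pos s _

/-- Each factor is at most (1 + x)/4 with x = 1/(2n₀), and (1 + x)^s ≤ e^{sx} ≤ 1 + 2sx because sx ≤
1. -/
theorem orth_prod_le (s : ℕ) :
    ∏ r ∈ range s, (1 / 4 + orthParam s (r + 1)) ≤
      (1 / 2 ^ s) ^ 2 * (1 + s / partSize s 0) := by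
  have h0 : (0 : ℝ) < partSize s 0 := by exact_mod_cast partSize_pos s 0
  have hs : (s : ℝ) ≤ partSize s 0 := by
    rw [partSize_zero]
    exact_mod_cast (Nat.lt_pow_self (by norm_num : 1 < 4)).le.trans
      (Nat.pow_le_pow_right (by norm_num) (by omega : s ≤ s + 8))
  set x : ℝ := 1 / (2 * partSize s 0) with hx
  have hx0 : 0 ≤ x := by positivity
  have hsx : s * x = s / partSize s 0 / 2 := by rw [hx]; field_simp
  have h1 : ∏ r ∈ range s, (1 / 4 + orthParam s (r + 1)) ≤ ∏ r ∈ range s, (1 / 4 * (1 + x)) := by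
    refine prod_le_prod (fun r _ => ?_) fun r _ => ?_
    · unfold orthParam; positivity
    · have := orthParam_le s r
      have h8 : 1 / (8 * (partSize s 0 : ℝ)) = 1 / 4 * x := by rw [hx]; field_simp; norm_num
      linarith
  refine h1.trans ?_
  rw [prod_const, card_range, mul_pow]
  have h4 : ((1 : ℝ) / 4) ^ s = (1 / 2 ^ s) ^ 2 := by
    rw [← one_div_pow, ← pow_mul, mul_comm, pow_mul]; norm_num
  rw [h4]
  gcongr
  have h5 : (1 + x) ^ s ≤ Real.exp (s * x) := by
    rw [mul_comm, ← Real.rpow_natCast, Real.exp_mul]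
    refine Real.rpow_le_rpow (by positivity) ?_ (by positivity)
    linarith [Real.add_one_le_exp x]
  have h6 : (s : ℝ) / partSize s 0 ≤ 1 := div_le_one_of_le₀ hs h0.le
  have h7 : |s * x| ≤ 1 := by
    rw [abs_of_nonneg (by positivity), hsx]; linarith
  have h9 := (le_abs_self _).trans (Real.abs_exp_sub_one_le h7)
  rw [abs_of_nonneg (by positivity), hsx] at h9
  rw [hsx] at h5
  linarith

/-- Two vertices on the right with different clusters in `X_0` have few common neighbors. -/
theorem codegree_le {s : ℕ} (K : Construction s) (b : ℕ) (i : Fin s → Bool) (v v' : Side s b)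
    (hv : v.1 0 ≠ v'.1 0) :
    (#{u : Side s b | K.finalColoring b u v = i ∧ K.finalColoring b u v' = i} : ℝ) ≤
      (1 / 2 ^ s) ^ 2 * (1 + s / partSize s 0) * Fintype.card (Side s b) := by
  have h3 : (#{u : Side s b | K.finalColoring b u v = i ∧ K.finalColoring b u v' = i} : ℝ) =
      #{x : Vtx s s | K.col s x v.1 = i ∧ K.col s x v'.1 = i} * b :=
    card_filter_fst b (fun x : Vtx s s => K.col s x v.1 = i ∧ K.col s x v'.1 = i)
  rw [h3, card_side]
  push_cast
  rw [← mul_assoc]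
  gcongr
  refine (K.card_common_nbr le_rfl v.1 v'.1 hv i).trans ?_
  gcongr
  exact orth_prod_le s

theorem card_cluster_zero (s b : ℕ) (a : Fin (partSize s 0)) :
    (#{v : Side s b | v.1 0 = a} : ℝ) = Fintype.card (Side s b) / partSize s 0 := by
  have h0 : (0 : ℝ) < partSize s 0 := by exact_mod_cast partSize_pos s 0
  rw [eq_div_iff h0.ne', card_side]
  have h3 : #{x : Vtx s s | x 0 = a} * partSize s 0 = Fintype.card (Vtx s s) := by
    have e := Fintype.card_congr (Fin.consEquiv (fun i : Fin (s + 1) => Fin (partSize s i)))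
    rw [Fintype.card_prod] at e
    have : #{x : Vtx s s | x 0 = a} =
        Fintype.card ((i : Fin s) → Fin (partSize s (Fin.succ i))) := by
      rw [← card_univ]
      symm
      refine Finset.card_bij
        (fun f _ => Fin.cons (α := fun i : Fin (s + 1) => Fin (partSize s i)) a f) ?_ ?_ ?_
      · intro f _
        rw [mem_filter]
        exact ⟨mem_univ _, rfl⟩
      · intro f _ g _ hfg
        exact Fin.cons_right_injective (α := fun i : Fin (s + 1) => Fin (partSize s i)) a hfg
      · intro x hx
        rw [mem_filter] at hx
        refine ⟨Fin.tail x, mem_univ _, ?_⟩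
        rw [← hx.2]
        exact Fin.cons_self_tail (α := fun i : Fin (s + 1) => Fin (partSize s i)) x
    rw [this, ← e, Fintype.card_fin, mul_comm]
    rfl
  have h4 : (#{v : Side s b | v.1 0 = a} : ℝ) = #{x : Vtx s s | x 0 = a} * b :=
    card_filter_fst b (fun x : Vtx s s => x 0 = a)
  rw [h4, ← h3]
  push_cast
  ring

/-- One-sided mixing for a single color. -/
theorem edgeCount_le {s : ℕ} (K : Construction s) (b : ℕ) (hb : 1 ≤ b) (i : Fin s → Bool)
    (A W : Finset (Side s b)) {p N : ℝ} (hp : p = 1 / 2 ^ s)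
    (hN : N = Fintype.card (Side s b)) :
    (edgeCount (K.finalColoring b) i A W : ℝ) ≤
      p * #A * #W + p * N * #A / 200 + 50 * p ^ 2 * N ^ 2 := by
  have hp0 : 0 < p := by rw [hp]; positivity
  have hN0 : 0 < N := by
    rw [hN, card_side]
    exact_mod_cast Nat.mul_pos (card_vtx_pos s s) hb
  have hn0 : (0 : ℝ) < partSize s 0 := by exact_mod_cast partSize_pos s 0
  -- The reason for n₀ = 4^(s+8): pairs in the same cluster of level 0, for which only the trivial
  -- codegree bound pN is used, form a fraction 1/n₀ = p²/2^16 of all pairs.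
  have hn : (partSize s 0 : ℝ) * p ^ 2 = 2 ^ 16 := by
    rw [partSize_zero, hp]; push_cast
    rw [one_div, inv_pow, ← pow_mul, mul_comm s 2, pow_mul, pow_add]
    norm_num
    field_simp
  have hsp : s * p ≤ 1 := by
    rw [hp, mul_one_div]
    refine div_le_one_of_le₀ ?_ (by positivity)
    exact_mod_cast (Nat.lt_two_pow_self (n := s)).le
  set X : Side s b → ℝ := fun u => #{v ∈ W | K.finalColoring b u v = i} with hX
  have hW : (#W : ℝ) ≤ N := by rw [hN]; exact_mod_cast card_le_univ W
  have hX1 : ∑ u, X u = #W * (p * N) := by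
    have : ∑ u, X u = ∑ v ∈ W, (#{u : Side s b | K.finalColoring b u v = i} : ℝ) := by
      simp only [hX, card_filter, Nat.cast_sum]
      exact sum_comm
    rw [this, sum_congr rfl fun v _ => edgeCount_neighbors' K b i v, sum_const, nsmul_eq_mul,
      hp, hN]
  have hX2 : ∑ u, X u ^ 2 ≤ #W ^ 2 * (p ^ 2 * (1 + s / partSize s 0) * N) +
      #W * (N / partSize s 0) * (p * N) := by
    have h1 : ∑ u, X u ^ 2 = ∑ v ∈ W, ∑ v' ∈ W,
        (#{u : Side s b | K.finalColoring b u v = i ∧ K.finalColoring b u v' = i} : ℝ) := by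
      have : ∀ u, X u ^ 2 = ∑ v ∈ W, ∑ v' ∈ W,
          if K.finalColoring b u v = i ∧ K.finalColoring b u v' = i then (1 : ℝ) else 0 := by
        intro u
        simp only [hX, card_filter, Nat.cast_sum, sq, sum_mul_sum]
        refine sum_congr rfl fun v _ => sum_congr rfl fun v' _ => ?_
        by_cases h : K.finalColoring b u v = i <;>
          by_cases h' : K.finalColoring b u v' = i <;> simp [h, h']
      rw [sum_congr rfl fun u _ => this u, sum_comm]
      refine sum_congr rfl fun v _ => ?_
      rw [sum_comm]
      refine sum_congr rfl fun v' _ => ?_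
      rw [card_filter, Nat.cast_sum]
      simp
    have h2 : ∀ v v' : Side s b,
        (#{u : Side s b | K.finalColoring b u v = i ∧ K.finalColoring b u v' = i} : ℝ) ≤
        p ^ 2 * (1 + s / partSize s 0) * N + if v'.1 0 = v.1 0 then p * N else 0 := by
      intro v v'
      split_ifs with h
      · have : (#{u : Side s b | K.finalColoring b u v = i ∧ K.finalColoring b u v' = i} : ℝ) ≤
            p * N := by
          rw [hp, hN, ← edgeCount_neighbors' K b i v]
          exact_mod_cast card_le_card fun u hu => by
            rw [mem_filter] at hu ⊢; exact ⟨hu.1, hu.2.1⟩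
        have : 0 ≤ p ^ 2 * (1 + s / partSize s 0) * N := by positivity
        linarith
      · rw [add_zero, hp, hN]
        exact codegree_le K b i v v' fun h' => h h'.symm
    rw [h1]
    refine (sum_le_sum fun v _ => sum_le_sum fun v' _ => h2 v v').trans ?_
    simp_rw [sum_add_distrib, sum_const, nsmul_eq_mul, ← sum_filter, sum_const, nsmul_eq_mul]
    have h3 : ∀ v ∈ W, (#{v' ∈ W | v'.1 0 = v.1 0} : ℝ) * (p * N) ≤
        N / partSize s 0 * (p * N) := by
      intro v _
      gcongr
      rw [hN, ← card_cluster_zero s b (v.1 0)]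
      exact Nat.cast_le.2 (card_le_card fun x hx => by
        simp only [mem_filter, mem_univ, true_and] at hx ⊢; exact hx.2)
    refine (add_le_add le_rfl (sum_le_sum h3)).trans_eq ?_
    rw [sum_const, nsmul_eq_mul]
    ring
  -- Variance of the degrees into `W`: the main terms p²|W|²N cancel, and the excess codegrees and
  -- the pairs in a common cluster contribute at most p³N³/2 each.
  have hV : ∑ u, (X u - p * #W) ^ 2 ≤ p ^ 3 * N ^ 3 := by
    have h1 : ∑ u, (X u - p * #W) ^ 2 =
        ∑ u, X u ^ 2 - 2 * (p * #W) * ∑ u, X u + N * (p * #W) ^ 2 := by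
      have : ∀ u, (X u - p * #W) ^ 2 = X u ^ 2 - 2 * (p * #W) * X u + (p * #W) ^ 2 :=
        fun u => by ring
      rw [sum_congr rfl fun u _ => this u, sum_add_distrib, sum_sub_distrib, ← mul_sum,
        sum_const, card_univ, nsmul_eq_mul, hN]
    have hq : (1 : ℝ) / partSize s 0 = p ^ 2 / 2 ^ 16 := by
      rw [← hn]; field_simp
    have hq1 : (s : ℝ) / partSize s 0 = s * (p ^ 2 / 2 ^ 16) := by rw [← hq]; ring
    have hq2 : N / partSize s 0 = N * (p ^ 2 / 2 ^ 16) := by rw [← hq]; ring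
    rw [hq1, hq2] at hX2
    rw [h1, hX1]
    have hW0 : (0 : ℝ) ≤ #W := by positivity
    have e1 : (#W : ℝ) ^ 2 ≤ N ^ 2 := by gcongr
    have e2 : (#W : ℝ) ^ 2 * (p ^ 2 * (s * (p ^ 2 / 2 ^ 16)) * N) ≤ p ^ 3 * N ^ 3 / 2 := by
      have : (#W : ℝ) ^ 2 * (p ^ 2 * (s * (p ^ 2 / 2 ^ 16)) * N) =
        (#W : ℝ) ^ 2 * (s * p) * (p ^ 3 * N / 2 ^ 16) := by ring
      rw [this]
      have : (#W : ℝ) ^ 2 * (s * p) * (p ^ 3 * N / 2 ^ 16) ≤ N ^ 2 * 1 * (p ^ 3 * N / 2 ^ 16) := by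
        gcongr
      have h0 : 0 ≤ p ^ 3 * N ^ 3 := by positivity
      nlinarith
    have e3 : (#W : ℝ) * (N * (p ^ 2 / 2 ^ 16)) * (p * N) ≤ p ^ 3 * N ^ 3 / 2 := by
      have : (#W : ℝ) * (N * (p ^ 2 / 2 ^ 16)) * (p * N) ≤ N * (N * (p ^ 2 / 2 ^ 16)) * (p * N) := by
        gcongr
      have h0 : 0 ≤ p ^ 3 * N ^ 3 := by positivity
      nlinarith
    linarith
  have hsum : (edgeCount (K.finalColoring b) i A W : ℝ) = ∑ u ∈ A, X u := by
    rw [edgeCount_eq_sum, Nat.cast_sum]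
  -- With t = X u - p|W|, the bound t ≤ pN/200 + 50t²/(pN) is the expansion of (t - pN/100)² ≥ 0; it
  -- turns the variance bound into a one-sided bound on any set `A`.
  have hpt : ∀ u, X u ≤ p * #W + p * N / 200 + 50 / (p * N) * (X u - p * #W) ^ 2 := by
    intro u
    have hpN : 0 < p * N := by positivity
    have h := sq_nonneg (X u - p * #W - p * N / 100)
    have : 50 / (p * N) * (X u - p * #W) ^ 2 - (X u - p * #W) + p * N / 200 =
        50 / (p * N) * (X u - p * #W - p * N / 100) ^ 2 := by
      field_simp; ring
    have h2 : 0 ≤ 50 / (p * N) * (X u - p * #W - p * N / 100) ^ 2 := by positivity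
    linarith
  rw [hsum]
  refine (sum_le_sum fun u _ => hpt u).trans ?_
  rw [sum_add_distrib, sum_const, nsmul_eq_mul, ← mul_sum]
  have h1 : ∑ u ∈ A, (X u - p * #W) ^ 2 ≤ p ^ 3 * N ^ 3 :=
    (sum_le_sum_of_subset_of_nonneg (subset_univ A) fun u _ _ => sq_nonneg _).trans hV
  have h2 : 50 / (p * N) * ∑ u ∈ A, (X u - p * #W) ^ 2 ≤ 50 / (p * N) * (p ^ 3 * N ^ 3) := by
    gcongr
  have h3 : 50 / (p * N) * (p ^ 3 * N ^ 3) = 50 * p ^ 2 * N ^ 2 := by field_simp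
  rw [h3] at h2
  linarith

/-! ### Cells and greedy chains -/

/-- The vertices `x` and `y` have the same ancestor in the graph number `r`. -/
def Agree {s : ℕ} (r : ℕ) (x y : Vtx s s) : Prop := ∀ k : Fin (s + 1), (k : ℕ) ≤ r → x k = y k

theorem agree_iff_res {s r : ℕ} (h : r ≤ s) (x y : Vtx s s) :
    Agree r x y ↔ res r h x = res r h y := by
  constructor
  · intro hxy
    funext k
    exact hxy ⟨k, by omega⟩ (by simp; omega)
  · intro hxy k hk
    exact congrFun hxy ⟨k, by omega⟩

theorem Agree.mono {s r t : ℕ} (h : t ≤ r) {x y : Vtx s s} (hxy : Agree r x y) : Agree t x y :=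
  fun k hk => hxy k (hk.trans h)

theorem Agree.symm {s r : ℕ} {x y : Vtx s s} (hxy : Agree r x y) : Agree r y x :=
  fun k hk => (hxy k hk).symm

theorem Agree.trans {s r : ℕ} {x y z : Vtx s s} (hxy : Agree r x y) (hyz : Agree r y z) :
    Agree r x z :=
  fun k hk => (hxy k hk).trans (hyz k hk)

/-- The elements of `Q` that lie in the cluster of `x` in `X_r`. -/
noncomputable def cell {s b : ℕ} (Q : Finset (Side s b)) (r : ℕ) (x : Vtx s s) :
    Finset (Side s b) := Q.filter fun u => Agree r u.1 x

theorem mem_cell {s b : ℕ} {Q : Finset (Side s b)} {r : ℕ} {x : Vtx s s} {u : Side s b} :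
    u ∈ cell Q r x ↔ u ∈ Q ∧ Agree r u.1 x := mem_filter

theorem cell_subset {s b : ℕ} (Q : Finset (Side s b)) (r : ℕ) (x : Vtx s s) : cell Q r x ⊆ Q :=
  filter_subset _ _

theorem cell_anti {s b : ℕ} (Q : Finset (Side s b)) {r t : ℕ} (h : r ≤ t) (x : Vtx s s) :
    cell Q t x ⊆ cell Q r x := fun u hu => by
  rw [mem_cell] at hu ⊢; exact ⟨hu.1, hu.2.mono h⟩

theorem cell_congr {s b : ℕ} (Q : Finset (Side s b)) {r : ℕ} {x y : Vtx s s} (h : Agree r x y) :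
    cell Q r x = cell Q r y := by
  ext u
  rw [mem_cell, mem_cell]
  exact and_congr_right fun _ => ⟨fun hu => hu.trans h, fun hu => hu.trans h.symm⟩

/-- Among the cells inside the cell of level `r` of `x`, the next cell of `x` is largest. -/
def IsGreedyAt {s b : ℕ} (Q : Finset (Side s b)) (x : Vtx s s) (r : ℕ) : Prop :=
  ∀ y, Agree r y x → #(cell Q (r + 1) y) ≤ #(cell Q (r + 1) x)

/-- The coordinates are chosen level by level. A later choice keeps the earlier coordinates, and a
cell of level r depends only on the coordinates up to r, so earlier maximality persists. -/
theorem exists_greedy {s b : ℕ} (Q : Finset (Side s b)) (a : Fin (partSize s 0)) :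
    ∃ x : Vtx s s, x 0 = a ∧ ∀ r < s, IsGreedyAt Q x r := by
  suffices h : ∀ t, ∃ x : Vtx s s, x 0 = a ∧ ∀ r < t, IsGreedyAt Q x r from h s
  intro t
  induction t with
  | zero =>
    exact ⟨Function.update (fun i => ⟨0, partSize_pos s i⟩) 0 a, Function.update_self _ _ _, fun r hr => by omega⟩
  | succ t ih =>
    obtain ⟨x, hx0, hx⟩ := ih
    obtain ⟨y, hy, hmax⟩ := exists_max_image (univ.filter fun y : Vtx s s => Agree t y x)
      (fun y => #(cell Q (t + 1) y)) ⟨x, by rw [mem_filter]; exact ⟨mem_univ _, fun _ _ => rfl⟩⟩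
    rw [mem_filter] at hy
    refine ⟨y, (hy.2 0 (by simp)).trans hx0, fun r hr z hz => ?_⟩
    rcases Nat.lt_succ_iff_lt_or_eq.1 hr with hr | rfl
    · rw [cell_congr Q (hy.2.mono hr)]
      exact hx r hr z (hz.trans (hy.2.mono hr.le))
    · exact hmax z (by rw [mem_filter]; exact ⟨mem_univ _, hz.trans hy.2⟩)

/-- Part `q.1` of the partition given by `ζ`, intersected with the cluster `q.2` of `X_0`. -/
noncomputable def piece {s b : ℕ} {ι : Type} (ζ : Side s b → ι) (q : ι × Fin (partSize s 0)) :
    Finset (Side s b) := univ.filter fun u => ζ u = q.1 ∧ u.1 0 = q.2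

theorem mem_piece {s b : ℕ} {ι : Type} {ζ : Side s b → ι} {q : ι × Fin (partSize s 0)}
    {u : Side s b} : u ∈ piece ζ q ↔ ζ u = q.1 ∧ u.1 0 = q.2 :=
  mem_filter.trans (and_iff_right (mem_univ _))

theorem mem_piece_self {s b : ℕ} {ι : Type} (ζ : Side s b → ι) (u : Side s b) :
    u ∈ piece ζ (ζ u, u.1 0) := mem_piece.2 ⟨rfl, rfl⟩

theorem piece_disjoint {s b : ℕ} {ι : Type} (ζ : Side s b → ι) {q q' : ι × Fin (partSize s 0)}
    (h : q ≠ q') : Disjoint (piece ζ q) (piece ζ q') := by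
  rw [disjoint_left]
  intro u hu hu'
  rw [mem_piece] at hu hu'
  exact h (Prod.ext (hu.1.symm.trans hu'.1) (hu.2.symm.trans hu'.2))

/-- The vertex whose ancestors are chosen greedily for a piece. -/
noncomputable def greedy {s b : ℕ} {ι : Type} (ζ : Side s b → ι) (q : ι × Fin (partSize s 0)) :
    Vtx s s := (exists_greedy (piece ζ q) q.2).choose

theorem greedy_isGreedyAt {s b : ℕ} {ι : Type} (ζ : Side s b → ι) (q : ι × Fin (partSize s 0))
    {r : ℕ} (hr : r < s) : IsGreedyAt (piece ζ q) (greedy ζ q) r :=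
  (exists_greedy (piece ζ q) q.2).choose_spec.2 r hr

theorem cell_greedy_zero {s b : ℕ} {ι : Type} (ζ : Side s b → ι) (q : ι × Fin (partSize s 0)) :
    cell (piece ζ q) 0 (greedy ζ q) = piece ζ q := by
  refine (cell_subset _ _ _).antisymm fun u hu => mem_cell.2 ⟨hu, fun k hk => ?_⟩
  obtain rfl : k = 0 := Fin.ext (by simpa using hk)
  rw [(mem_piece.1 hu).2]
  exact (exists_greedy (piece ζ q) q.2).choose_spec.1.symm

/-! ### Colors -/

/-- The colors `a` and `i` differ for the first time in position `r`. -/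
def FirstDiff {s : ℕ} (r : ℕ) (a i : Fin s → Bool) : Prop :=
  (∀ k : Fin s, (k : ℕ) < r → a k = i k) ∧ ∃ k : Fin s, (k : ℕ) = r ∧ a k ≠ i k

/-- This uniqueness allows recolored edges found at different levels to be added without double
counting. -/
theorem FirstDiff.unique {s r r' : ℕ} {a i : Fin s → Bool} (h : FirstDiff r a i)
    (h' : FirstDiff r' a i) : r = r' := by
  obtain ⟨h1, k, rfl, hk⟩ := h
  obtain ⟨h1', k', rfl, hk'⟩ := h'
  rcases lt_trichotomy (k : ℕ) k' with hlt | heq | hlt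
  · exact absurd (h1' k hlt) hk
  · exact heq
  · exact absurd (h1 k' hlt) hk'

theorem FirstDiff.ne {s r : ℕ} {a i : Fin s → Bool} (h : FirstDiff r a i) : a ≠ i := by
  rintro rfl
  obtain ⟨_, k, _, hk⟩ := h
  exact hk rfl

theorem finalColoring_bit {s : ℕ} (K : Construction s) (b : ℕ) {r : ℕ} (hr : r < s)
    (u v : Side s b) :
    K.finalColoring b u v ⟨r, hr⟩ =
      xor (K.left r (res r hr.le u.1) (res r hr.le v.1) (u.1 ⟨r + 1, by omega⟩))
        (K.right r (res r hr.le v.1) (res r hr.le u.1) (v.1 ⟨r + 1, by omega⟩)) := by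
  have h := congrFun (K.col_res (show r + 1 ≤ s from hr) u.1 v.1) (Fin.last r)
  rw [K.col_succ_last] at h
  exact h.symm

theorem finalColoring_cut {s : ℕ} (K : Construction s) (b : ℕ) {r : ℕ} (hr : r ≤ s)
    (u v : Side s b) :
    K.col r (res r hr u.1) (res r hr v.1) = cut r hr (K.finalColoring b u v) :=
  K.col_res hr u.1 v.1

theorem firstDiff_of_bit {s : ℕ} {r : ℕ} (hr : r < s) {a i : Fin s → Bool}
    (h : cut r hr.le a = cut r hr.le i) (h' : a ⟨r, hr⟩ ≠ i ⟨r, hr⟩) : FirstDiff r a i :=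
  ⟨fun k hk => congrFun h ⟨k, hk⟩, ⟨r, hr⟩, rfl, h'⟩

/-! ### A regular pair that is split -/

/-- If the pair `(C, T)` is regular and both classes of `C` are large, then many edges
join classes that should not be joined. -/
theorem split_pair {U V E : Type} [DecidableEq E] (c : U → V → E) (i : E) (C : Finset U) (T : Finset V)
    (f : U → Bool) (g : V → Bool) (β : Bool) {d ε m : ℝ} (hm : 0 ≤ m)
    (hC : ∀ l, m ≤ #{u ∈ C | f u = l})
    (hreg : ∀ A ⊆ C, ∀ B ⊆ T, m ≤ #A → (#T : ℝ) / 2 ≤ #B →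
      |d * (#A * #B) - edgeCount c i A B| ≤ ε * (#A * #B)) :
    m / 2 * (edgeCount c i C T - 2 * ε * (#C * #T)) ≤
      #C * #{e ∈ C ×ˢ T | c e.1 e.2 = i ∧ xor (f e.1) (g e.2) ≠ β} := by
  have hmC : m ≤ #C := (hC true).trans (by exact_mod_cast card_filter_le _ _)
  -- Nothing is known about how `T` is split, but one of its two classes contains at least half of
  -- it.
  obtain ⟨l, hl⟩ : ∃ l, (#T : ℝ) / 2 ≤ #{v ∈ T | g v = l} := by
    by_contra! h
    have h1 := h true
    have h2 := h false
    have h3 := card_filter_add_card_filter_not (s := T) (fun v => g v = true)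
    simp only [Bool.not_eq_true] at h3
    have h4 : (#T : ℝ) = #{v ∈ T | g v = true} + #{v ∈ T | g v = false} := by exact_mod_cast h3.symm
    linarith
  -- The class of `C` whose edges to `B` have the wrong bit. Since both classes of `C` are large, it
  -- does not matter which one is required.
  set A := {u ∈ C | f u = !(xor β l)} with hA
  set B := {v ∈ T | g v = l} with hB
  have hAm : m ≤ #A := hC _
  have h1 := (abs_le.1 (hreg A (filter_subset _ _) B (filter_subset _ _) hAm hl)).2
  have h2 := (abs_le.1 (hreg C subset_rfl T subset_rfl hmC
    (by linarith [Nat.cast_nonneg (α := ℝ) #T]))).1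
  have h3 : edgeCount c i A B ≤ #{e ∈ C ×ˢ T | c e.1 e.2 = i ∧ xor (f e.1) (g e.2) ≠ β} := by
    refine card_le_card fun e he => ?_
    simp only [mem_filter, mem_product, hA, hB] at he ⊢
    obtain ⟨⟨⟨h1, h2⟩, h3, h4⟩, h5⟩ := he
    refine ⟨⟨h1, h3⟩, h5, ?_⟩
    rw [h2, h4]
    cases β <;> cases l <;> simp
  have h3' : (edgeCount c i A B : ℝ) ≤
    #{e ∈ C ×ˢ T | c e.1 e.2 = i ∧ xor (f e.1) (g e.2) ≠ β} := by exact_mod_cast h3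
  have hT0 : (0 : ℝ) ≤ #T := Nat.cast_nonneg _
  have hC0 : (0 : ℝ) ≤ #C := Nat.cast_nonneg _
  have hle : m / 2 * (edgeCount c i C T - 2 * ε * (#C * #T)) ≤
      #C * ((d - ε) * (m * (#T / 2))) := by
    have := mul_le_mul_of_nonneg_left
      (show (edgeCount c i C T - 2 * ε * (#C * #T) : ℝ) ≤ (d - ε) * (#C * #T) by linarith)
      (show 0 ≤ m / 2 by linarith)
    linarith
  refine hle.trans (mul_le_mul_of_nonneg_left ?_ hC0)
  -- For d < ε the lower bound (d - ε)|A||B| cannot be estimated through lower bounds on |A| and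
  -- |B|, but then the claimed bound is nonpositive.
  rcases le_total (d - ε) 0 with hd | hd
  · exact (mul_nonpos_of_nonpos_of_nonneg hd (by positivity)).trans (Nat.cast_nonneg _)
  · have : m * (#T / 2) ≤ (#A : ℝ) * #B := mul_le_mul hAm hl (by positivity) (by positivity)
    have := mul_le_mul_of_nonneg_left this hd
    linarith

/-! ### Counting over one cell -/

/-- `card_splitting` with the sizes of the child cells as weights; the greedy child is the heaviest
point, so l becomes the loss of the cell in this step. -/
theorem card_splitting_cell {s : ℕ} (K : Construction s) (b : ℕ) {r : ℕ} (hr : r < s)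
    (Q : Finset (Side s b)) (x : Vtx s s) (hx : IsGreedyAt Q x r) (i : Fin s → Bool) :
    (degreeParam s r : ℝ) / 6 ≤ #{Y : Vtx s r | K.col r (res r hr.le x) Y = cut r hr.le i ∧
      ∀ l, ((#(cell Q r x) : ℝ) - #(cell Q (r + 1) x)) / 16 ≤
        #{u ∈ cell Q r x | K.left r (res r hr.le x) Y (u.1 ⟨r + 1, by omega⟩) = l}} := by
  have hr1 : r + 1 < s + 1 := by omega
  set C := cell Q r x with hC
  set w : Fin (partSize s (r + 1)) → ℝ := fun a => #{u ∈ C | u.1 ⟨r + 1, hr1⟩ = a} with hw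
  have hcell : ∀ y : Vtx s s, Agree r y x →
      w (y ⟨r + 1, hr1⟩) = #(cell Q (r + 1) y) := by
    intro y hy
    simp only [hw, Nat.cast_inj]
    congr 1
    ext u
    simp only [mem_filter, hC, mem_cell]
    constructor
    · rintro ⟨⟨h1, h2⟩, h3⟩
      refine ⟨h1, fun k hk => ?_⟩
      rcases Nat.le_succ_iff.1 hk with hk | hk
      · exact (h2.trans hy.symm) k hk
      · obtain rfl : k = ⟨r + 1, hr1⟩ := Fin.ext hk
        exact h3
    · rintro ⟨h1, h2⟩
      exact ⟨⟨h1, (h2.mono (Nat.le_succ r)).trans hy⟩, h2 _ le_rfl⟩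
  have hmax : ∀ a, w a ≤ w (x ⟨r + 1, hr1⟩) := by
    intro a
    set y : Vtx s s := Function.update x ⟨r + 1, hr1⟩ a with hy
    have hyx : Agree r y x := by
      intro k hk
      rw [hy, Function.update_of_ne]
      rintro rfl
      simp at hk
    have hya : y ⟨r + 1, hr1⟩ = a := by rw [hy, Function.update_self]
    rw [← hya, hcell y hyx, hcell x fun _ _ => rfl]
    exact_mod_cast hx y hyx
  have hsum : ∀ (B : Fin (partSize s (r + 1)) → Bool) (l : Bool), ∑ a with B a = l, w a =
      #{u ∈ C | B (u.1 ⟨r + 1, hr1⟩) = l} := by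
    intro B l
    simp only [hw]
    rw [← Nat.cast_sum, Nat.cast_inj]
    rw [card_eq_sum_card_fiberwise (s := {u ∈ C | B (u.1 ⟨r + 1, hr1⟩) = l})
      (t := {a | B a = l}) (f := fun u => u.1 ⟨r + 1, hr1⟩)
      (fun u hu => by simpa using (mem_filter.1 hu).2)]
    refine sum_congr rfl fun a ha => ?_
    rw [filter_filter]
    congr 1
    ext u
    simp only [mem_filter, mem_univ, true_and] at ha ⊢
    refine and_congr_right fun _ => ⟨fun h => ⟨by rw [h]; exact ha, h⟩, fun h => h.2⟩
  have htot : ∑ a, w a = #C := by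
    simp only [hw]
    rw [← Nat.cast_sum, Nat.cast_inj]
    exact (card_eq_sum_card_fiberwise fun u _ => mem_coe.2 (mem_univ _)).symm
  have h := card_splitting (K.left_seq r hr (res r hr.le x) (cut r hr.le i)) w
    (fun a => Nat.cast_nonneg _) (x ⟨r + 1, hr1⟩) hmax
  rw [htot, hcell x fun _ _ => rfl] at h
  refine h.trans (Nat.cast_le.2 (card_le_card fun Y hY => ?_))
  simp only [mem_filter, mem_univ, true_and] at hY ⊢
  exact ⟨hY.1, fun l => by rw [← hsum]; exact hY.2 l⟩

theorem card_nbr_in_cluster_side {s : ℕ} (K : Construction s) (b : ℕ) {r : ℕ} (hr : r < s)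
    (i : Fin s → Bool) (u : Side s b) (Y : Vtx s r)
    (hY : K.col r (res r hr.le u.1) Y = cut r hr.le i) :
    (#{v : Side s b | res r hr.le v.1 = Y ∧ K.finalColoring b u v = i} : ℝ) *
      degreeParam s r = 1 / 2 ^ s * Fintype.card (Side s b) := by
  have h := K.card_nbr_in_cluster hr.le le_rfl u.1 Y i hY
  have h3 : (#{v : Side s b | res r hr.le v.1 = Y ∧ K.finalColoring b u v = i} : ℝ) =
      #{x : Vtx s s | res r hr.le x = Y ∧ K.col s u.1 x = i} * b :=
    card_filter_fst b (fun x : Vtx s s => res r hr.le x = Y ∧ K.col s u.1 x = i)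
  rw [← degreeParam_mul K hr] at h
  rw [h3, card_side, ← h]
  have : (2 : ℝ) ^ s = 2 ^ (s - r) * 2 ^ r := by rw [← pow_add]; congr 1; omega
  rw [this]
  push_cast
  field_simp

/-- The main local estimate: a set that splits at level `r` forces edges whose color differs
from the original one for the first time in position `r`. -/
theorem wrong_lower {s : ℕ} (K : Construction s) (b : ℕ) {r : ℕ} (hr : r < s)
    (new : Side s b → Side s b → (Fin s → Bool)) (i : Fin s → Bool)
    (Q : Finset (Side s b)) (x : Vtx s s) (hx : IsGreedyAt Q x r)
    {κ : Type} [Fintype κ] (T : κ → Finset (Side s b)) (y : κ → Vtx s s)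
    (hT : ∀ k k', k ≠ k' → Disjoint (T k) (T k')) (hy : ∀ k, ∀ v ∈ T k, Agree r v.1 (y k))
    (Good : Finset κ) {ε m p N η : ℝ} (hη : ∑ k with k ∉ Good, (#(T k) : ℝ) ≤ η) (hε : 0 ≤ ε) (hp : p = 1 / 2 ^ s)
    (hN : N = Fintype.card (Side s b))
    (hm : m ≤ ((#(cell Q r x) : ℝ) - #(cell Q (r + 1) x)) / 16)
    (hreg : ∀ k ∈ Good, ∃ d : ℝ, ∀ A ⊆ Q, ∀ B ⊆ T k, m ≤ #A → (#(T k) : ℝ) / 2 ≤ #B →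
      |d * (#A * #B) - edgeCount new i A B| ≤ ε * (#A * #B)) :
    ((#(cell Q r x) : ℝ) - #(cell Q (r + 1) x)) / 32 *
      (#(cell Q r x) * (p * N / 6 - 2 * ε * N)
        - (edgeCount (K.finalColoring b) i Q (univ.filter fun v => ∀ k, v ∉ T k) +
          #{e ∈ Q ×ˢ univ | K.finalColoring b e.1 e.2 = i ∧ new e.1 e.2 ≠ i} +
          #Q * η)) ≤
      #(cell Q r x) * #{e ∈ Q ×ˢ univ | new e.1 e.2 = i ∧
        FirstDiff r (K.finalColoring b e.1 e.2) i} := by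
  set C := cell Q r x with hC
  set l := (#C : ℝ) - #(cell Q (r + 1) x) with hl
  have hl0 : 0 ≤ l := by
    rw [hl, sub_nonneg]; exact_mod_cast card_le_card (cell_anti Q (Nat.le_succ r) x)
  set S : Finset (Vtx s r) := {Y : Vtx s r | K.col r (res r hr.le x) Y = cut r hr.le i ∧
      ∀ c, l / 16 ≤ #{u ∈ C | K.left r (res r hr.le x) Y (u.1 ⟨r + 1, by omega⟩) = c}} with hS
  have hScard : (degreeParam s r : ℝ) / 6 ≤ #S := card_splitting_cell K b hr Q x hx i
  -- The cores that form a regular pair with `Q` and lie in a cluster whose bipartition splits `C`.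
  set G : Finset κ := {k ∈ Good | res r hr.le (y k) ∈ S} with hG
  have hresC : ∀ u ∈ C, res r hr.le u.1 = res r hr.le x := fun u hu =>
    (agree_iff_res hr.le _ _).1 (mem_cell.1 hu).2
  have hresT : ∀ k, ∀ v ∈ T k, res r hr.le v.1 = res r hr.le (y k) := fun k v hv =>
    (agree_iff_res hr.le _ _).1 (hy k v hv)
  -- the edges in split regular pairs
  have hpairs : ∀ k ∈ G, l / 32 * (edgeCount new i C (T k) - 2 * ε * (#C * #(T k))) ≤
      #C * #{e ∈ C ×ˢ T k | new e.1 e.2 = i ∧ FirstDiff r (K.finalColoring b e.1 e.2) i} := by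
    intro k hk
    rw [hG, mem_filter, hS, mem_filter] at hk
    obtain ⟨hk1, -, hk2, hk3⟩ := hk
    obtain ⟨d, hd⟩ := hreg k hk1
    have h := split_pair new i C (T k)
      (fun u => K.left r (res r hr.le x) (res r hr.le (y k)) (u.1 ⟨r + 1, by omega⟩))
      (fun v => K.right r (res r hr.le (y k)) (res r hr.le x) (v.1 ⟨r + 1, by omega⟩))
      (i ⟨r, hr⟩) (d := d) (ε := ε) (m := l / 16) (by positivity) hk3
      (fun A hA B hB hAm hBm => hd A (hA.trans (cell_subset _ _ _)) B hB (hm.trans hAm) hBm)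
    rw [show l / 32 = l / 16 / 2 by ring]
    refine h.trans (mul_le_mul_of_nonneg_left (Nat.cast_le.2 (card_le_card fun e he => ?_))
      (Nat.cast_nonneg _))
    simp only [mem_filter, mem_product] at he ⊢
    refine ⟨he.1, he.2.1, firstDiff_of_bit hr ?_ ?_⟩
    · rw [← finalColoring_cut, hresC _ he.1.1, hresT k _ he.1.2, hk2]
    · rw [finalColoring_bit, hresC _ he.1.1, hresT k _ he.1.2]
      exact he.2.2
  have hdisj : ∀ (P : Side s b × Side s b → Prop) [DecidablePred P] (G : Finset κ),
      (G : Set κ).PairwiseDisjoint fun k => (C ×ˢ T k).filter P := by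
    intro P _ G k _ k' _ hkk
    refine Finset.disjoint_filter_filter ?_
    rw [disjoint_product]
    exact Or.inr (hT k k' hkk)
  have hwrong : ∑ k ∈ G, #{e ∈ C ×ˢ T k | new e.1 e.2 = i ∧
      FirstDiff r (K.finalColoring b e.1 e.2) i} ≤
      #{e ∈ Q ×ˢ univ | new e.1 e.2 = i ∧ FirstDiff r (K.finalColoring b e.1 e.2) i} := by
    rw [← card_biUnion (hdisj _ G)]
    refine card_le_card fun e he => ?_
    simp only [mem_biUnion, mem_filter, mem_product] at he ⊢
    obtain ⟨k, _, he1, he2⟩ := he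
    exact ⟨⟨cell_subset _ _ _ he1.1, mem_univ _⟩, he2⟩
  have hTN : ∑ k ∈ G, (#(T k) : ℝ) ≤ N := by
    rw [hN, ← Nat.cast_sum, ← card_biUnion fun k _ k' _ h => hT k k' h]
    exact_mod_cast card_le_univ _
  -- the original edges at split clusters
  set F : Finset (Side s b × Side s b) :=
    {e ∈ C ×ˢ univ | K.finalColoring b e.1 e.2 = i ∧ res r hr.le e.2.1 ∈ S} with hF
  -- Each vertex of `C` sends exactly pN/d_r original edges of color `i` to each cluster in `S`, and
  -- there are at least d_r/6 such clusters.
  have hFcard : #C * (p * N / 6) ≤ (#F : ℝ) := by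
    have hd0 : (0 : ℝ) < degreeParam s r := by
      have h1 := degreeParam_mul K hr
      have h2 := card_vtx_pos s r
      rw [← h1] at h2
      exact_mod_cast Nat.pos_of_mul_pos_left h2
    have h1 : #F = ∑ u ∈ C, ∑ Y ∈ S,
        #{v : Side s b | res r hr.le v.1 = Y ∧ K.finalColoring b u v = i} := by
      rw [hF, card_filter, sum_product]
      refine sum_congr rfl fun u _ => ?_
      rw [← card_filter, card_eq_sum_card_fiberwise (t := S) (f := fun v => res r hr.le v.1)
        (fun v hv => by simpa using (mem_filter.1 hv).2.2)]
      refine sum_congr rfl fun Y hY => ?_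
      congr 1
      ext v
      simp only [mem_filter, mem_univ, true_and]
      constructor
      · rintro ⟨⟨h1, h2⟩, h3⟩; exact ⟨h3, h1⟩
      · rintro ⟨rfl, h1⟩; exact ⟨⟨h1, hY⟩, rfl⟩
    rw [h1, Nat.cast_sum, ← nsmul_eq_mul, ← sum_const]
    refine sum_le_sum fun u hu => ?_
    have h2 : ∀ Y ∈ S, (#{v : Side s b | res r hr.le v.1 = Y ∧ K.finalColoring b u v = i} : ℝ) =
        p * N / degreeParam s r := by
      intro Y hY
      rw [eq_div_iff hd0.ne', hp, hN]
      refine card_nbr_in_cluster_side K b hr i u Y ?_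
      rw [hresC u hu]
      exact (mem_filter.1 hY).2.1
    rw [Nat.cast_sum, sum_congr rfl h2, sum_const, nsmul_eq_mul]
    have h3 : p * N / 6 = degreeParam s r / 6 * (p * N / degreeParam s r) := by field_simp
    rw [h3]
    refine mul_le_mul_of_nonneg_right hScard ?_
    rw [hp, hN]; positivity
  -- An edge of `F` ends outside all cores, or has lost color `i`, or ends in a core that is not
  -- good, or still has color `i` and joins `C` to a core in `G`. The three errors are counted over
  -- all of `Q`, so that the bound does not depend on r.
  have hcover : #F ≤ ∑ k ∈ G, edgeCount new i C (T k) +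
      (edgeCount (K.finalColoring b) i Q (univ.filter fun v => ∀ k, v ∉ T k) +
        #{e ∈ Q ×ˢ univ | K.finalColoring b e.1 e.2 = i ∧ new e.1 e.2 ≠ i} +
        #Q * ∑ k with k ∉ Good, #(T k)) := by
    have h1 : #Q * ∑ k with k ∉ Good, #(T k) =
        #(Q ×ˢ (univ.filter fun k => k ∉ Good).biUnion T) := by
      rw [card_product, card_biUnion fun k _ k' _ h => hT k k' h]
    have h2 : ∑ k ∈ G, edgeCount new i C (T k) =
        #(G.biUnion fun k => (C ×ˢ T k).filter fun e => new e.1 e.2 = i) :=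
      (card_biUnion (hdisj _ G)).symm
    rw [h1, h2, edgeCount]
    refine le_trans (card_le_card ?_) ((card_union_le _ _).trans (Nat.add_le_add_left
      ((card_union_le _ _).trans (Nat.add_le_add_right (card_union_le _ _) _)) _))
    intro e he
    rw [hF, mem_filter, mem_product] at he
    obtain ⟨⟨he1, -⟩, he2, he3⟩ := he
    have heQ := cell_subset _ _ _ he1
    simp only [mem_union, mem_biUnion, mem_filter, mem_product, mem_univ, true_and, and_true]
    by_cases hW : ∀ k, e.2 ∉ T k
    · exact Or.inr (Or.inl (Or.inl ⟨⟨heQ, hW⟩, he2⟩))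
    push Not at hW
    obtain ⟨k, hk⟩ := hW
    by_cases hnew : new e.1 e.2 = i
    · by_cases hgood : k ∈ Good
      · refine Or.inl ⟨k, ?_, ⟨he1, hk⟩, hnew⟩
        rw [hG, mem_filter, ← hresT k _ hk]
        exact ⟨hgood, he3⟩
      · exact Or.inr (Or.inr ⟨heQ, k, hgood, hk⟩)
    · exact Or.inr (Or.inl (Or.inr ⟨heQ, he2, hnew⟩))
  have hcover' : (#F : ℝ) ≤ ∑ k ∈ G, (edgeCount new i C (T k) : ℝ) +
      (edgeCount (K.finalColoring b) i Q (univ.filter fun v => ∀ k, v ∉ T k) +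
        #{e ∈ Q ×ˢ univ | K.finalColoring b e.1 e.2 = i ∧ new e.1 e.2 ≠ i} +
        #Q * ∑ k with k ∉ Good, (#(T k) : ℝ)) := by exact_mod_cast hcover
  have hmain : l / 32 * (∑ k ∈ G, (edgeCount new i C (T k) : ℝ) - 2 * ε * (#C * N)) ≤
      #C * #{e ∈ Q ×ˢ univ | new e.1 e.2 = i ∧ FirstDiff r (K.finalColoring b e.1 e.2) i} := by
    have h1 := sum_le_sum hpairs
    rw [← mul_sum, ← mul_sum, sum_sub_distrib, ← mul_sum, ← mul_sum] at h1
    refine le_trans (mul_le_mul_of_nonneg_left (sub_le_sub_left ?_ _) (by positivity))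
      (h1.trans (mul_le_mul_of_nonneg_left (by exact_mod_cast hwrong) (Nat.cast_nonneg _)))
    gcongr
  refine le_trans (mul_le_mul_of_nonneg_left ?_ (by positivity)) hmain
  have := mul_le_mul_of_nonneg_left hη (Nat.cast_nonneg (α := ℝ) #Q)
  linarith

/-! ### Summation over the levels -/

/-- While f ≥ q/2 the drops telescope to q - f(k). Once f falls below q/2, the drops already counted
exceed q/2. -/
theorem sum_large_drops {f : ℕ → ℝ} {q : ℝ} (hf0 : f 0 = q) (hf : ∀ r, f (r + 1) ≤ f r) (k : ℕ) :
    min (q - f k) (q / 2) ≤ ∑ r ∈ range k with q / 2 ≤ f r, (f r - f (r + 1)) := by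
  induction k with
  | zero => simp [hf0]
  | succ k ih =>
    rw [range_add_one, filter_insert]
    have h := hf k
    split_ifs with hk
    · rw [sum_insert (by simp)]
      have : min (q - f k) (q / 2) = q - f k := min_eq_left (by linarith)
      have := min_le_left (q - f (k + 1)) (q / 2)
      linarith
    · have : min (q - f k) (q / 2) = q / 2 := min_eq_right (by linarith)
      have := min_le_right (q - f (k + 1)) (q / 2)
      linarith

/-- Only levels with f r ≥ q/2 and a drop of at least γq/(2s) are used. The first condition keeps
the error E, which belongs to the whole piece, comparable to the cell; the second makes the split
classes large enough for regularity. The at most s smaller drops lose at most γq/2 of a total of γq.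
-/
theorem sum_levels {f w : ℕ → ℝ} {q E D γ : ℝ} {R s : ℕ} (hq : 0 < q) (hE : 0 ≤ E) (hγ : 0 ≤ γ)
    (hγ1 : γ ≤ 1 / 2) (hf0 : f 0 = q) (hf : ∀ r, f (r + 1) ≤ f r) (hR : R < s)
    (hfR : f (R + 1) < (1 - γ) * q) (hw : ∀ r, 0 ≤ w r)
    (h : ∀ r < R + 1, q / 2 ≤ f r → γ * q / (2 * s) ≤ f r - f (r + 1) →
      (f r - f (r + 1)) / 32 * (f r * D - E) ≤ f r * w r) :
    γ / 64 * (q * D - 2 * E) ≤ ∑ r ∈ range (R + 1), w r := by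
  -- At a level with f r ≥ q/2 one has E ≤ f r · 2E/q, so f r · D - E ≥ f r · D' and the factor f r
  -- cancels.
  set D' := D - 2 * E / q with hD'
  have hqD : q * D - 2 * E = q * D' := by rw [hD']; field_simp
  rw [hqD]
  rcases le_total D' 0 with hD0 | hD0
  · exact (mul_nonpos_of_nonneg_of_nonpos (by positivity)
      (mul_nonpos_of_nonneg_of_nonpos hq.le hD0)).trans (sum_nonneg fun r _ => hw r)
  have hs : (0 : ℝ) < s := by exact_mod_cast (by omega : 0 < s)
  set A := {r ∈ range (R + 1) | q / 2 ≤ f r} with hA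
  have h1 := sum_large_drops hf0 hf (R + 1)
  rw [← hA] at h1
  have h2 : γ * q ≤ ∑ r ∈ A, (f r - f (r + 1)) := by
    refine le_trans (le_min ?_ ?_) h1
    · linarith
    · nlinarith
  have h3 : ∑ r ∈ A with ¬ γ * q / (2 * s) ≤ f r - f (r + 1), (f r - f (r + 1)) ≤ γ * q / 2 := by
    have hcard : (#{r ∈ A | ¬ γ * q / (2 * s) ≤ f r - f (r + 1)} : ℝ) ≤ s := by
      have h4 := (card_filter_le A fun r => ¬ γ * q / (2 * s) ≤ f r - f (r + 1)).trans
        (card_filter_le (range (R + 1)) fun r => q / 2 ≤ f r)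
      rw [card_range] at h4
      exact_mod_cast h4.trans hR
    refine (sum_le_card_nsmul _ _ (γ * q / (2 * s)) fun r hr => ?_).trans ?_
    · exact (not_le.1 (mem_filter.1 hr).2).le
    · rw [nsmul_eq_mul]
      refine (mul_le_mul_of_nonneg_right hcard (by positivity)).trans_eq ?_
      field_simp
  have h4 := sum_filter_add_sum_filter_not A (fun r => γ * q / (2 * s) ≤ f r - f (r + 1))
    (fun r => f r - f (r + 1))
  have h5 : ∀ r ∈ A.filter fun r => γ * q / (2 * s) ≤ f r - f (r + 1),
      D' / 32 * (f r - f (r + 1)) ≤ w r := by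
    intro r hr
    rw [mem_filter, hA, mem_filter, mem_range] at hr
    obtain ⟨⟨hr1, hr2⟩, hr3⟩ := hr
    have hfr : 0 < f r := by linarith
    have h6 := h r hr1 hr2 hr3
    have h7 : f r * D' ≤ f r * D - E := by
      have : E ≤ f r * (2 * E / q) := by
        rw [mul_div_assoc', le_div_iff₀ hq]; nlinarith
      rw [hD', mul_sub]; linarith
    have h8 := mul_le_mul_of_nonneg_left h7
      (show 0 ≤ (f r - f (r + 1)) / 32 by linarith [hf r])
    refine le_of_mul_le_mul_left ?_ hfr
    linarith
  have h9 := sum_le_sum h5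
  rw [← mul_sum] at h9
  have h10 : ∑ r ∈ A.filter (fun r => γ * q / (2 * s) ≤ f r - f (r + 1)), w r ≤
      ∑ r ∈ range (R + 1), w r :=
    sum_le_sum_of_subset_of_nonneg ((filter_subset _ _).trans (filter_subset _ _))
      fun r _ _ => hw r
  have h11 : D' / 32 * (γ * q / 2) ≤
      D' / 32 * ∑ r ∈ A with γ * q / (2 * s) ≤ f r - f (r + 1), (f r - f (r + 1)) :=
    mul_le_mul_of_nonneg_left (by linarith) (by positivity)
  linarith

/-! ### The masses of the pieces that are not nearly contained in a cluster -/

section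

variable {s b : ℕ} {ι : Type}

/-- The total size of the pieces that are not `γ`-contained in the greedily chosen cluster
of level `r`. -/
noncomputable def mass [Fintype ι] (ζ : Side s b → ι) (γ : ℝ) (r : ℕ) : ℝ :=
  ∑ q with (#(cell (piece ζ q) r (greedy ζ q)) : ℝ) < (1 - γ) * #(piece ζ q), (#(piece ζ q) : ℝ)

theorem mass_zero [Fintype ι] (ζ : Side s b → ι) {γ : ℝ} (hγ : 0 ≤ γ) : mass ζ γ 0 = 0 := by
  refine sum_eq_zero fun q hq => ?_
  rw [mem_filter, cell_greedy_zero] at hq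
  nlinarith [hq.2, Nat.cast_nonneg (α := ℝ) #(piece ζ q)]

theorem sum_card_piece_fst (ζ : Side s b → ι) (z : ι) :
    ∑ a, #(piece ζ (z, a)) = #{u | ζ u = z} := by
  rw [card_eq_sum_card_fiberwise (t := univ) (f := fun u : Side s b => u.1 0)
    (fun u _ => mem_coe.2 (mem_univ _))]
  refine sum_congr rfl fun a _ => ?_
  congr 1
  ext u
  simp only [mem_piece, mem_filter, mem_univ, true_and]

theorem sum_card_piece [Fintype ι] (ζ : Side s b → ι) :
    ∑ q, (#(piece ζ q) : ℝ) = Fintype.card (Side s b) := by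
  rw [Fintype.sum_prod_type]
  simp_rw [← Nat.cast_sum, sum_card_piece_fst]
  rw [Nat.cast_inj, ← card_univ]
  exact (card_eq_sum_card_fiberwise fun u _ => mem_coe.2 (mem_univ _)).symm

theorem sum_card_le_card {α β : Type} (S : Finset α) (F : α → Finset β) (D : Finset β)
    (hd : ∀ a ∈ S, ∀ a' ∈ S, a ≠ a' → Disjoint (F a) (F a')) (hD : ∀ a ∈ S, F a ⊆ D) :
    ∑ a ∈ S, #(F a) ≤ #D := by
  rw [← card_biUnion hd]
  exact card_le_card (biUnion_subset.2 hD)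

theorem sum_size [Fintype ι] {ζ ζ' : Side s b → ι} {size : ι → ℝ}
    (hsize : ∀ z, (#{u | ζ u = z} : ℝ) + #{v | ζ' v = z} = size z) :
    ∑ z, size z = 2 * Fintype.card (Side s b) := by
  have h : ∀ η : Side s b → ι, ∑ z, (#{u | η u = z} : ℝ) = Fintype.card (Side s b) := fun η => by
    rw [← Nat.cast_sum, Nat.cast_inj, ← card_univ]
    exact (card_eq_sum_card_fiberwise fun u _ => mem_coe.2 (mem_univ _)).symm
  rw [← sum_congr rfl fun z _ => hsize z, sum_add_distrib, h, h]
  ring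

theorem sum_size_fst [Fintype ι] {ζ ζ' : Side s b → ι} {size : ι → ℝ}
    (hsize : ∀ z, (#{u | ζ u = z} : ℝ) + #{v | ζ' v = z} = size z) :
    ∑ q : ι × Fin (partSize s 0), size q.1 = 2 * partSize s 0 * Fintype.card (Side s b) := by
  rw [Fintype.sum_prod_type]
  simp only [sum_const, card_univ, Fintype.card_fin, nsmul_eq_mul]
  rw [← mul_sum, sum_size hsize]
  ring

/-! ### The numerical contradiction, cores and irregular pairs -/

/-- The main term is about P·NB/6 with P = nI·p ≥ g² and B ≥ 64gN, so it is of order at least g³N².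
The errors E₁ and E₃ are small multiples of P·NB, and E₂ ≤ g⁴N² is smaller by a factor g. After
multiplication by 128g/64 = 2g at least 2g⁴N² remains, against the allowed g⁴N². -/
theorem final_estimate {N g p nI B W E₁ E₂ E₃ : ℝ} (hN : 0 < N) (hg : 0 < g) (hg1 : g ≤ 1 / 2 ^ 16)
    (hp : 0 < p) (hpg : p ≤ g / 2 ^ 20) (hB : 64 * g * N ≤ B)
    (hW : W ≤ 288 * g * N) (hnI : g ^ 2 ≤ nI * p)
    (hE₁ : E₁ ≤ nI * (p * B * W + p * N * B / 200 + 50 * p ^ 2 * N ^ 2))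
    (hE₂ : E₂ ≤ g ^ 4 * N ^ 2) (hE₃ : E₃ ≤ nI * (p ^ 5 * (2 * N) ^ 2))
    (h : 128 * g / 64 * (nI * (B * (p * N / 6 - 2 * p ^ 5 * N)) - 2 * (E₁ + E₂ + E₃)) ≤
      g ^ 4 * N ^ 2) : False := by
  have hB0 : 0 < B := lt_of_lt_of_le (by positivity) hB
  set P := nI * p with hP
  have hP0 : 0 < P := lt_of_lt_of_le (by positivity) hnI
  have hp1 : p ≤ 1 / 2 ^ 20 := hpg.trans (by
    refine div_le_div_of_nonneg_right (hg1.trans (by norm_num)) (by norm_num))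
  have hp4 : p ^ 4 ≤ p := by
    have : p ^ 3 ≤ 1 := pow_le_one₀ hp.le (hp1.trans (by norm_num))
    calc p ^ 4 = p * p ^ 3 := by ring
      _ ≤ p * 1 := by gcongr
      _ = p := mul_one p
  have hpN : p * N ≤ B / 2 ^ 26 := by
    have := mul_le_mul_of_nonneg_right hpg hN.le
    linarith
  have h1 : E₁ ≤ P * (N * B) * (1 / 50) := by
    refine hE₁.trans ?_
    have e1 : B * W ≤ N * B / 200 := by
      have := mul_le_mul_of_nonneg_left hW hB0.le
      have := mul_le_mul_of_nonneg_left hg1 (show 0 ≤ 288 * (N * B) by positivity)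
      have : 0 < N * B := by positivity
      linarith
    have e2 : 50 * p * N ^ 2 ≤ N * B / 200 := by
      have := mul_le_mul_of_nonneg_left hpN (show 0 ≤ 50 * N by positivity)
      have : 0 < N * B := by positivity
      linarith
    have : nI * (p * B * W + p * N * B / 200 + 50 * p ^ 2 * N ^ 2) =
      P * (B * W + N * B / 200 + 50 * p * N ^ 2) := by rw [hP]; ring
    rw [this, mul_assoc P]
    refine mul_le_mul_of_nonneg_left ?_ hP0.le
    have : 0 < N * B := by positivity
    linarith
  have h3 : E₃ ≤ P * (N * B) * (1 / 1000) := by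
    refine hE₃.trans ?_
    have : nI * (p ^ 5 * (2 * N) ^ 2) = P * (4 * p ^ 4 * N ^ 2) := by rw [hP]; ring
    rw [this, mul_assoc P]
    refine mul_le_mul_of_nonneg_left ?_ hP0.le
    have e1 := mul_le_mul_of_nonneg_right hp4 (show 0 ≤ 4 * N ^ 2 by positivity)
    have e2 := mul_le_mul_of_nonneg_left hpN (show 0 ≤ 4 * N by positivity)
    have : 0 < N * B := by positivity
    linarith
  have h4 : P * (N * B) * (1 / 6 - 1 / 1000) ≤ nI * (B * (p * N / 6 - 2 * p ^ 5 * N)) := by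
    have : nI * (B * (p * N / 6 - 2 * p ^ 5 * N)) = P * (N * B) * (1 / 6 - 2 * p ^ 4) := by
      rw [hP]; ring
    rw [this]
    refine mul_le_mul_of_nonneg_left ?_ (by positivity)
    have : (1 : ℝ) / 2 ^ 20 ≤ 1 / 2000 := by norm_num
    linarith
  have h5 : 64 * g ^ 3 * N ^ 2 ≤ P * (N * B) := by
    calc 64 * g ^ 3 * N ^ 2 = g ^ 2 * (N * (64 * g * N)) := by ring
      _ ≤ P * (N * B) := by gcongr
  have h6 : g ^ 4 ≤ g ^ 3 * (1 / 2 ^ 16) := by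
    rw [pow_succ]; gcongr
  have h7 : g ^ 4 * N ^ 2 ≤ g ^ 3 * N ^ 2 * (1 / 2 ^ 16) := by
    have := mul_le_mul_of_nonneg_right h6 (sq_nonneg N)
    linarith
  have h8 : 0 < g ^ 3 * N ^ 2 := by positivity
  have h9 : g ^ 3 * N ^ 2 ≤ nI * (B * (p * N / 6 - 2 * p ^ 5 * N)) - 2 * (E₁ + E₂ + E₃) := by
    linarith
  have h10 := mul_le_mul_of_nonneg_left h9 (show 0 ≤ 128 * g / 64 by positivity)
  have h11 : 0 < g ^ 4 * N ^ 2 := by positivity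
  have h12 : 128 * g / 64 * (g ^ 3 * N ^ 2) = 2 * (g ^ 4 * N ^ 2) := by ring
  linarith

/-- The good part of a piece on the right: its main cell, if this is large. -/
noncomputable def core (ζ : Side s b → ι) (size : ι → ℝ) (τ γ : ℝ) (R : ℕ)
    (k : ι × Fin (partSize s 0)) : Finset (Side s b) :=
  if τ * size k.1 ≤ #(piece ζ k) ∧
    (1 - γ) * #(piece ζ k) ≤ #(cell (piece ζ k) R (greedy ζ k)) then
    cell (piece ζ k) R (greedy ζ k) else ∅

theorem core_subset (ζ : Side s b → ι) (size : ι → ℝ) (τ γ : ℝ) (R : ℕ)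
    (k : ι × Fin (partSize s 0)) : core ζ size τ γ R k ⊆ piece ζ k := by
  unfold core
  split_ifs
  · exact cell_subset _ _ _
  · exact empty_subset _

theorem agree_of_mem_core {ζ : Side s b → ι} {size : ι → ℝ} {τ γ : ℝ} {R : ℕ}
    {k : ι × Fin (partSize s 0)} {v : Side s b} (hv : v ∈ core ζ size τ γ R k) :
    Agree R v.1 (greedy ζ k) := by
  unfold core at hv
  split_ifs at hv
  · exact (mem_cell.1 hv).2
  · exact absurd hv (notMem_empty v)

theorem core_disjoint (ζ : Side s b → ι) (size : ι → ℝ) (τ γ : ℝ) (R : ℕ)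
    {k k' : ι × Fin (partSize s 0)} (h : k ≠ k') :
    Disjoint (core ζ size τ γ R k) (core ζ size τ γ R k') :=
  disjoint_of_subset_left (core_subset _ _ _ _ _ _)
    (disjoint_of_subset_right (core_subset _ _ _ _ _ _) (piece_disjoint ζ h))

/-- A vertex outside the cores lies in a piece that is not nearly contained in its greedy cell, in a
piece that is tiny compared to its part, or in the lost γ-fraction of a remaining piece. -/
theorem card_not_core_le [Fintype ι] (ζ : Side s b → ι) (size : ι → ℝ) (hsize : ∀ z, 0 ≤ size z)
    {τ γ : ℝ} (hτ : 0 ≤ τ) (hγ : 0 ≤ γ) (R : ℕ) :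
    (#{v : Side s b | ∀ k, v ∉ core ζ size τ γ R k} : ℝ) ≤
      mass ζ γ R + τ * ∑ k : ι × Fin (partSize s 0), size k.1 +
        γ * Fintype.card (Side s b) := by
  have h1 : (univ.filter fun v : Side s b => ∀ k, v ∉ core ζ size τ γ R k) ⊆
      univ.biUnion fun k => piece ζ k \ core ζ size τ γ R k := by
    intro v hv
    rw [mem_biUnion]
    exact ⟨_, mem_univ _, mem_sdiff.2 ⟨mem_piece_self ζ v, (mem_filter.1 hv).2 _⟩⟩
  have h2 : (#{v : Side s b | ∀ k, v ∉ core ζ size τ γ R k} : ℝ) ≤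
      ∑ k, (#(piece ζ k \ core ζ size τ γ R k) : ℝ) := by
    exact_mod_cast (card_le_card h1).trans card_biUnion_le
  refine h2.trans ?_
  rw [← sum_card_piece ζ, mass, sum_filter, mul_sum, mul_sum, ← sum_add_distrib,
    ← sum_add_distrib]
  refine sum_le_sum fun k _ => ?_
  have h3 : (0 : ℝ) ≤ #(piece ζ k) := Nat.cast_nonneg _
  have h4 := mul_nonneg hτ (hsize k.1)
  have h5 := mul_nonneg hγ h3
  have h6 : (#(piece ζ k \ core ζ size τ γ R k) : ℝ) ≤ #(piece ζ k) := by
    exact_mod_cast card_le_card sdiff_subset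
  split_ifs with hc
  · linarith
  · by_cases ht : τ * size k.1 ≤ #(piece ζ k)
    · have : core ζ size τ γ R k = cell (piece ζ k) R (greedy ζ k) :=
        if_pos ⟨ht, not_lt.1 hc⟩
      rw [this, cast_card_sdiff (cell_subset _ _ _)]
      linarith [not_lt.1 hc]
    · linarith [not_le.1 ht]

theorem sum_irregular_le [Fintype ι] (ζ ζ' : Side s b → ι) {size : ι → ℝ}
    (hsize : ∀ z, (#{u | ζ u = z} : ℝ) + #{v | ζ' v = z} = size z) (τ γ : ℝ) (R : ℕ)
    (Irr : ι → ι → Prop) (B : Finset (ι × Fin (partSize s 0))) :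
    ∑ q ∈ B, (#(piece ζ q) : ℝ) * ∑ k with Irr q.1 k.1, (#(core ζ' size τ γ R k) : ℝ) ≤
      ∑ z, ∑ z', if Irr z z' then size z * size z' else 0 := by
  have hs0 : ∀ z, 0 ≤ size z := fun z => by rw [← hsize]; positivity
  obtain ⟨H, hH⟩ : ∃ H : ι → ℝ, ∀ z, H z = ∑ z', if Irr z z' then size z' else 0 :=
    ⟨_, fun _ => rfl⟩
  have h1 : ∀ z, ∑ k : ι × Fin (partSize s 0) with Irr z k.1, (#(core ζ' size τ γ R k) : ℝ) ≤
      H z := by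
    intro z
    rw [hH, sum_filter, Fintype.sum_prod_type]
    refine sum_le_sum fun z' _ => ?_
    dsimp only
    split_ifs
    · refine (sum_le_sum fun a _ => Nat.cast_le.2 (card_le_card (core_subset _ _ _ _ _ _))).trans ?_
      rw [← Nat.cast_sum, sum_card_piece_fst, ← hsize]
      linarith [Nat.cast_nonneg (α := ℝ) #{u | ζ u = z'}]
    · simp
  have h2 : ∀ z, 0 ≤ H z := fun z => by
    rw [hH]
    exact sum_nonneg fun z' _ => by split_ifs; exacts [hs0 z', le_rfl]
  calc _ ≤ ∑ q ∈ B, (#(piece ζ q) : ℝ) * H q.1 :=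
        sum_le_sum fun q _ => mul_le_mul_of_nonneg_left (h1 q.1) (Nat.cast_nonneg _)
    _ ≤ ∑ q, (#(piece ζ q) : ℝ) * H q.1 :=
        sum_le_sum_of_subset_of_nonneg (subset_univ B)
          fun q _ _ => mul_nonneg (Nat.cast_nonneg _) (h2 _)
    _ ≤ _ := by
        rw [Fintype.sum_prod_type]
        refine sum_le_sum fun z _ => ?_
        dsimp only
        rw [← sum_mul, ← Nat.cast_sum, sum_card_piece_fst]
        have : (#{u | ζ u = z} : ℝ) ≤ size z := by
          rw [← hsize]; linarith [Nat.cast_nonneg (α := ℝ) #{v | ζ' v = z}]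
        refine (mul_le_mul_of_nonneg_right this (h2 z)).trans_eq ?_
        rw [hH, mul_sum]
        refine sum_congr rfl fun z' _ => ?_
        split_ifs <;> simp

end

/-! ### Summation over pieces and colors, and the induction step -/

theorem edgeCount_biUnion {U V E κ : Type} [DecidableEq U] [DecidableEq E] (c : U → V → E) (i : E)
    (S : Finset κ) (F : κ → Finset U) (B : Finset V)
    (hd : ∀ a ∈ S, ∀ a' ∈ S, a ≠ a' → Disjoint (F a) (F a')) :
    ∑ q ∈ S, edgeCount c i (F q) B = edgeCount c i (S.biUnion F) B := by
  simp_rw [edgeCount_eq_sum]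
  rw [sum_biUnion hd]

/-- The colors of the edges of `u` and `v` are changed from `i` to another color. -/
theorem sum_removed_le {s b : ℕ} {ι : Type} (ζ : Side s b → ι)
    (old new : Side s b → Side s b → (Fin s → Bool)) (B : Finset (ι × Fin (partSize s 0)))
    (I : Finset (Fin s → Bool)) :
    ∑ q ∈ B, ∑ i ∈ I, #{e ∈ piece ζ q ×ˢ univ | old e.1 e.2 = i ∧ new e.1 e.2 ≠ i} ≤
      #{e : Side s b × Side s b | new e.1 e.2 ≠ old e.1 e.2} := by
  rw [← sum_product']
  refine sum_card_le_card _ _ _ ?_ ?_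
  · rintro ⟨q, i⟩ - ⟨q', i'⟩ - hne
    rw [disjoint_left]
    intro e he he'
    simp only [mem_filter, mem_product, mem_univ, and_true] at he he'
    refine hne (Prod.ext ?_ (he.2.1.symm.trans he'.2.1))
    by_contra h
    exact disjoint_left.1 (piece_disjoint ζ h) he.1 he'.1
  · rintro ⟨q, i⟩ - e he
    simp only [mem_filter, mem_product, mem_univ, and_true, true_and] at he ⊢
    rw [he.2.1]
    exact he.2.2

/-- An edge determines its left piece, its new color and the first bit in which the old color
differs, so it is counted at most once. -/
theorem sum_wrong_le {s b : ℕ} {ι : Type} (ζ : Side s b → ι)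
    (old new : Side s b → Side s b → (Fin s → Bool)) (B : Finset (ι × Fin (partSize s 0)))
    (I : Finset (Fin s → Bool)) (S : Finset ℕ) :
    ∑ q ∈ B, ∑ i ∈ I, ∑ r ∈ S,
        #{e ∈ piece ζ q ×ˢ univ | new e.1 e.2 = i ∧ FirstDiff r (old e.1 e.2) i} ≤
      #{e : Side s b × Side s b | new e.1 e.2 ≠ old e.1 e.2} := by
  simp_rw [← sum_product']
  refine sum_card_le_card _ _ _ ?_ ?_
  · rintro ⟨q, i, r⟩ - ⟨q', i', r'⟩ - hne
    rw [disjoint_left]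
    intro e he he'
    simp only [mem_filter, mem_product, mem_univ, and_true] at he he'
    obtain ⟨h1, rfl, h2⟩ := he
    obtain ⟨h1', rfl, h2'⟩ := he'
    obtain rfl := h2.unique h2'
    have : q ≠ q' := fun h => hne (by rw [h])
    exact disjoint_left.1 (piece_disjoint ζ this) h1 h1'
  · rintro ⟨q, i, r⟩ - e he
    simp only [mem_filter, mem_product, mem_univ, and_true, true_and] at he ⊢
    rw [he.2.1]
    exact he.2.2.ne.symm

theorem sum_sum_affine {α β : Type} (B : Finset α) (I : Finset β) (Q : α → ℝ) (D c : ℝ)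
    (x y z : α → β → ℝ) :
    ∑ q ∈ B, ∑ i ∈ I, c * (Q q * D - 2 * (x q i + y q i + z q i)) =
      c * (#I * ((∑ q ∈ B, Q q) * D) -
        2 * (∑ q ∈ B, ∑ i ∈ I, x q i + ∑ q ∈ B, ∑ i ∈ I, y q i + ∑ q ∈ B, ∑ i ∈ I, z q i)) := by
  simp_rw [← mul_sum, sum_sub_distrib, ← mul_sum, sum_add_distrib, ← sum_mul, sum_const,
    nsmul_eq_mul]
  ring

/-- If few pieces on the right are not nearly contained in a cluster of level `R`, then few
pieces on the left are not nearly contained in a cluster of level `R + 1`. -/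
theorem mass_step {s b : ℕ} {ι : Type} [Fintype ι] (K : Construction s) (hb : 1 ≤ b)
    {N p g : ℝ} (hN : N = Fintype.card (Side s b)) (hp : p = 1 / 2 ^ s) (hg : 0 < g)
    (hg1 : g ≤ 1 / 2 ^ 16) (hsp : s * p ≤ g) (hpg : p ≤ g / 2 ^ 20)
    (new : Side s b → Side s b → (Fin s → Bool))
    (hnew : (#{e : Side s b × Side s b | new e.1 e.2 ≠ K.finalColoring b e.1 e.2} : ℝ) ≤
      g ^ 4 * N ^ 2)
    (I : Finset (Fin s → Bool)) (hI : g ^ 2 ≤ #I * p)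
    (ζ ζ' : Side s b → ι) (size : ι → ℝ)
    (hsize : ∀ z, (#{u | ζ u = z} : ℝ) + #{v | ζ' v = z} = size z)
    (Irr : (Fin s → Bool) → ι → ι → Prop)
    (hIrr : ∀ i ∈ I, ∑ z, ∑ z', (if Irr i z z' then size z * size z' else 0) ≤
      p ^ 5 * (2 * N) ^ 2)
    (hreg : ∀ i ∈ I, ∀ z z', ¬ Irr i z z' → ∃ d : ℝ, ∀ A : Finset (Side s b),
      (∀ u ∈ A, ζ u = z) → ∀ B : Finset (Side s b), (∀ v ∈ B, ζ' v = z') →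
      p ^ 5 * size z ≤ #A → p ^ 5 * size z' ≤ #B →
      |d * (#A * #B) - edgeCount new i A B| ≤ p ^ 5 * (#A * #B))
    {R : ℕ} (hR : R < s) (hmass : mass ζ' (128 * g) R ≤ 128 * g * N) :
    mass ζ (128 * g) (R + 1) ≤ 128 * g * N := by
  by_contra! hcon
  have hp0 : 0 < p := by rw [hp]; positivity
  have hN0 : 0 < N := by
    rw [hN, card_side]
    exact_mod_cast Nat.mul_pos (card_vtx_pos s s) hb
  have hs0 : (0 : ℝ) < s := by exact_mod_cast (by omega : 0 < s)
  have hsize0 : ∀ z, 0 ≤ size z := fun z => by rw [← hsize]; positivity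
  set γ := 128 * g with hγ
  have hγ0 : 0 < γ := by positivity
  have hγ1 : γ ≤ 1 / 512 := by
    have := mul_le_mul_of_nonneg_left hg1 (show (0 : ℝ) ≤ 128 by norm_num)
    rw [hγ]; linarith
  have hp1 : p ≤ 1 / 4 := by
    have : g / 2 ^ 20 ≤ g := div_le_self hg.le (by norm_num)
    linarith
  have hn : (partSize s 0 : ℝ) * p ^ 2 = 2 ^ 16 := by
    rw [partSize_zero, hp]; push_cast
    rw [one_div, inv_pow, ← pow_mul, mul_comm s 2, pow_mul, pow_add]
    norm_num
    field_simp
  -- Pieces smaller than p⁴ times their part have total size at most 2n₀p⁴N = 2^17 p²N.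
  have htiny : p ^ 4 * ∑ k : ι × Fin (partSize s 0), size k.1 ≤ 32 * g * N := by
    rw [sum_size_fst hsize, ← hN]
    have h1 : p ^ 4 * (2 * partSize s 0 * N) = 2 ^ 17 * p * p * N := by
      have : p ^ 4 * (2 * partSize s 0 * N) = 2 * (partSize s 0 * p ^ 2) * p ^ 2 * N := by ring
      rw [this, hn]; ring
    rw [h1]
    have h2 : 2 ^ 17 * p * p ≤ 32 * g := by
      have : 2 ^ 17 * p * p ≤ 2 ^ 17 * (g / 2 ^ 20) * 1 := by gcongr; linarith
      linarith
    exact mul_le_mul_of_nonneg_right h2 hN0.le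
  set T := core ζ' size (p ^ 4) γ R with hT
  set W : Finset (Side s b) := univ.filter fun v => ∀ k, v ∉ T k with hW
  -- 288 = 128 + 32 + 128: the mass at level `R`, the tiny pieces and the lost γ-fractions.
  have hWcard : (#W : ℝ) ≤ 288 * g * N := by
    have h := card_not_core_le ζ' size hsize0 (τ := p ^ 4) (by positivity) hγ0.le R
    rw [← hN] at h
    have : (#W : ℝ) ≤ _ := h
    linarith
  set B : Finset (ι × Fin (partSize s 0)) := {q | ((#(cell (piece ζ q) (R + 1) (greedy ζ q)) : ℝ) <
    (1 - γ) * #(piece ζ q)) ∧ p ^ 4 * size q.1 ≤ #(piece ζ q)} with hB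
  have hBcard : 64 * g * N ≤ ∑ q ∈ B, (#(piece ζ q) : ℝ) := by
    have h1 : mass ζ γ (R + 1) ≤
        ∑ q ∈ B, (#(piece ζ q) : ℝ) + p ^ 4 * ∑ k : ι × Fin (partSize s 0), size k.1 := by
      rw [mass, hB, sum_filter, sum_filter, mul_sum, ← sum_add_distrib]
      refine sum_le_sum fun q _ => ?_
      have h2 : 0 ≤ p ^ 4 * size q.1 := mul_nonneg (by positivity) (hsize0 _)
      have h3 : (0 : ℝ) ≤ #(piece ζ q) := Nat.cast_nonneg _
      by_cases ha : (#(cell (piece ζ q) (R + 1) (greedy ζ q)) : ℝ) < (1 - γ) * #(piece ζ q)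
      · by_cases hc : p ^ 4 * size q.1 ≤ #(piece ζ q)
        · rw [if_pos ha, if_pos ⟨ha, hc⟩]; linarith
        · rw [if_pos ha, if_neg fun h => hc h.2]; linarith [not_le.1 hc]
      · rw [if_neg ha, if_neg fun h => ha h.1]; linarith
    have : 0 < g * N := by positivity
    linarith
  set old := K.finalColoring b with hold
  set E : ι × Fin (partSize s 0) → (Fin s → Bool) → ℝ := fun q i =>
    edgeCount old i (piece ζ q) W +
      #{e ∈ piece ζ q ×ˢ univ | old e.1 e.2 = i ∧ new e.1 e.2 ≠ i} +
      #(piece ζ q) * ∑ k with Irr i q.1 k.1, (#(T k) : ℝ) with hE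
  have hlocal : ∀ q ∈ B, ∀ i ∈ I,
      γ / 64 * (#(piece ζ q) * (p * N / 6 - 2 * p ^ 5 * N) - 2 * E q i) ≤
      ∑ r ∈ range (R + 1), (#{e ∈ piece ζ q ×ˢ univ | new e.1 e.2 = i ∧
        FirstDiff r (old e.1 e.2) i} : ℝ) := by
    intro q hq i hi
    rw [hB, mem_filter] at hq
    obtain ⟨-, hq1, hq2⟩ := hq
    have hQ0 : (0 : ℝ) < #(piece ζ q) := by
      have h1 : (0 : ℝ) < (1 - γ) * #(piece ζ q) := lt_of_le_of_lt (Nat.cast_nonneg _) hq1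
      exact (pos_iff_pos_of_mul_pos h1).1 (by linarith)
    have hE0 : 0 ≤ E q i := by
      have : (0 : ℝ) ≤ ∑ k with Irr i q.1 k.1, (#(T k) : ℝ) := sum_nonneg fun _ _ => Nat.cast_nonneg _
      exact add_nonneg (add_nonneg (Nat.cast_nonneg _) (Nat.cast_nonneg _))
        (mul_nonneg hQ0.le this)
    refine sum_levels (f := fun r => (#(cell (piece ζ q) r (greedy ζ q)) : ℝ))
      (w := fun r => (#{e ∈ piece ζ q ×ˢ univ | new e.1 e.2 = i ∧
        FirstDiff r (old e.1 e.2) i} : ℝ)) (q := #(piece ζ q)) (E := E q i)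
      (D := p * N / 6 - 2 * p ^ 5 * N) (γ := γ) hQ0 hE0
      hγ0.le (by linarith) (by rw [cell_greedy_zero])
      (fun r => Nat.cast_le.2 (card_le_card (cell_anti _ (Nat.le_succ r) _))) hR hq1
      (fun r => Nat.cast_nonneg _) fun r hr _ hr2 => ?_
    have h := wrong_lower K b (show r < s by omega) new i (piece ζ q) (greedy ζ q)
      (greedy_isGreedyAt ζ q (by omega)) T (greedy ζ')
      (fun k k' h => core_disjoint _ _ _ _ _ h)
      (fun k v hv => (agree_of_mem_core hv).mono (by omega))
      (univ.filter fun k => ¬ Irr i q.1 k.1) (ε := p ^ 5)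
      (η := ∑ k with Irr i q.1 k.1, (#(T k) : ℝ))
      (m := γ * #(piece ζ q) / (32 * s)) (p := p) (N := N) ?_ (by positivity) hp hN ?_ ?_
    · exact h
    · refine (sum_congr ?_ fun _ _ => rfl).le
      ext k
      simp
    · have : γ * #(piece ζ q) / (32 * s) = γ * #(piece ζ q) / (2 * s) / 16 := by
        field_simp; norm_num
      rw [this]
      exact div_le_div_of_nonneg_right hr2 (by norm_num)
    · intro k hk
      rw [mem_filter] at hk
      obtain ⟨d, hd⟩ := hreg i hi q.1 k.1 hk.2
      -- The threshold p⁴ leaves a factor p to spare below the regularity threshold p⁵: on the left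
      -- it pays for γ/(32s), as 32sp ≤ γ; on the right for passing to half of a core. Otherwise the
      -- core is empty and any density works.
      by_cases hk2 : p ^ 4 * size k.1 ≤ #(piece ζ' k) ∧
          (1 - γ) * #(piece ζ' k) ≤ #(cell (piece ζ' k) R (greedy ζ' k))
      · refine ⟨d, fun A hA B' hB' hAm hBm => hd A (fun u hu => (mem_piece.1 (hA hu)).1) B'
          (fun v hv => (mem_piece.1 (core_subset _ _ _ _ _ _ (hB' hv))).1) ?_ ?_⟩
        · refine le_trans ?_ hAm
          rw [le_div_iff₀ (by positivity)]
          have h1 : p ^ 5 * size q.1 * (32 * s) = 32 * (s * p) * (p ^ 4 * size q.1) := by ring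
          rw [h1]
          exact mul_le_mul (by rw [hγ]; linarith) hq2
            (mul_nonneg (by positivity) (hsize0 _)) hγ0.le
        · refine le_trans ?_ hBm
          have h1 : T k = cell (piece ζ' k) R (greedy ζ' k) := if_pos hk2
          rw [h1]
          have h2 : p ^ 5 * size k.1 ≤ 1 / 4 * (p ^ 4 * size k.1) := by
            have : p ^ 5 * size k.1 = p * (p ^ 4 * size k.1) := by ring
            rw [this]
            exact mul_le_mul_of_nonneg_right hp1 (mul_nonneg (by positivity) (hsize0 _))
          have h3 : 1 / 2 * (#(piece ζ' k) : ℝ) ≤ (1 - γ) * #(piece ζ' k) :=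
            mul_le_mul_of_nonneg_right (by linarith) (Nat.cast_nonneg _)
          linarith [hk2.1, hk2.2]
      · have h1 : T k = ∅ := if_neg hk2
        refine ⟨0, fun A _ B' hB' _ _ => ?_⟩
        rw [h1, subset_empty] at hB'
        simp [hB', edgeCount]
  have hsum := sum_le_sum fun q hq => sum_le_sum (hlocal q hq)
  have hwr : ∑ q ∈ B, ∑ i ∈ I, ∑ r ∈ range (R + 1), (#{e ∈ piece ζ q ×ˢ univ |
      new e.1 e.2 = i ∧ FirstDiff r (old e.1 e.2) i} : ℝ) ≤ g ^ 4 * N ^ 2 := by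
    refine le_trans ?_ hnew
    exact_mod_cast sum_wrong_le ζ old new B I (range (R + 1))
  have hE₁ : ∑ q ∈ B, ∑ i ∈ I, (edgeCount old i (piece ζ q) W : ℝ) ≤
      #I * (p * (∑ q ∈ B, (#(piece ζ q) : ℝ)) * #W +
        p * N * (∑ q ∈ B, (#(piece ζ q) : ℝ)) / 200 + 50 * p ^ 2 * N ^ 2) := by
    rw [sum_comm, ← nsmul_eq_mul]
    refine sum_le_card_nsmul _ _ _ fun i _ => ?_
    have h1 : ∀ a ∈ B, ∀ a' ∈ B, a ≠ a' → Disjoint (piece ζ a) (piece ζ a') :=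
      fun a _ a' _ h => piece_disjoint ζ h
    rw [← Nat.cast_sum, edgeCount_biUnion _ _ _ _ _ h1, ← Nat.cast_sum, ← card_biUnion h1]
    exact edgeCount_le K b hb i _ W hp hN
  have hE₂ : ∑ q ∈ B, ∑ i ∈ I,
      (#{e ∈ piece ζ q ×ˢ univ | old e.1 e.2 = i ∧ new e.1 e.2 ≠ i} : ℝ) ≤ g ^ 4 * N ^ 2 := by
    refine le_trans ?_ hnew
    exact_mod_cast sum_removed_le ζ old new B I
  have hE₃ : ∑ q ∈ B, ∑ i ∈ I, (#(piece ζ q) : ℝ) * ∑ k with Irr i q.1 k.1, (#(T k) : ℝ) ≤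
      #I * (p ^ 5 * (2 * N) ^ 2) := by
    rw [sum_comm, ← nsmul_eq_mul]
    exact sum_le_card_nsmul _ _ _ fun i hi =>
      (sum_irregular_le ζ ζ' hsize (p ^ 4) γ R (Irr i) B).trans (hIrr i hi)
  refine final_estimate hN0 hg hg1 hp0 hpg hBcard hWcard hI hE₁ hE₂ hE₃ ?_
  have h := hsum.trans hwr
  simp only [hE, sum_sum_affine] at h
  exact h

/-! ### From regular partitions of the final graph to the two sides -/

section

variable {s b : ℕ}

theorem interedges_colorGraph (c : Side s b → Side s b → (Fin s → Bool)) (i : Fin s → Bool)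
    (A B : Finset (Side s b)) :
    #((colorGraph c i).interedges (A.map Function.Embedding.inl)
      (B.map Function.Embedding.inr)) = edgeCount c i A B := by
  symm
  refine card_bij (fun e _ => (Sum.inl e.1, Sum.inr e.2)) ?_ ?_ ?_
  · intro e he
    rw [mem_filter, mem_product] at he
    rw [SimpleGraph.mem_interedges_iff]
    refine ⟨mem_map_of_mem _ he.1.1, mem_map_of_mem _ he.1.2, ?_⟩
    rw [colorGraph, SimpleGraph.fromRel_adj]
    exact ⟨by simp, Or.inl ⟨e.1, e.2, rfl, rfl, he.2⟩⟩
  · intro e _ e' _ h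
    simp only [Prod.mk.injEq, Sum.inl.injEq, Sum.inr.injEq] at h
    exact Prod.ext h.1 h.2
  · rintro ⟨x, y⟩ h
    rw [SimpleGraph.mem_interedges_iff] at h
    obtain ⟨h1, h2, h3⟩ := h
    obtain ⟨u, hu, rfl⟩ := mem_map.1 h1
    obtain ⟨v, hv, rfl⟩ := mem_map.1 h2
    refine ⟨(u, v), ?_, rfl⟩
    rw [colorGraph, SimpleGraph.fromRel_adj] at h3
    rw [mem_filter, mem_product]
    refine ⟨⟨hu, hv⟩, ?_⟩
    rcases h3.2 with ⟨a, c, ha, hc, h⟩ | ⟨a, c, ha, hc, h⟩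
    · obtain rfl := Sum.inl_injective ha
      obtain rfl := Sum.inr_injective hc
      exact h
    · exact absurd ha (by simp)

theorem regular_left {c : Side s b → Side s b → (Fin s → Bool)} {i : Fin s → Bool}
    {ε : ℝ} {z z' : Finset (Vertex s b)} (h : IsRegularPair (colorGraph c i) ε z z')
    (A B : Finset (Side s b)) (hA : ∀ u ∈ A, Sum.inl u ∈ z) (hB : ∀ v ∈ B, Sum.inr v ∈ z')
    (hA' : ε * #z ≤ #A) (hB' : ε * #z' ≤ #B) :
    |((colorGraph c i).edgeDensity z z' : ℝ) * (#A * #B) - edgeCount c i A B| ≤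
      ε * (#A * #B) := by
  have h1 := h (A.map Function.Embedding.inl) (map_subset_iff_subset_preimage.2 fun u hu => by
      rw [mem_preimage]; exact hA u hu)
    (B.map Function.Embedding.inr) (map_subset_iff_subset_preimage.2 fun u hu => by
      rw [mem_preimage]; exact hB u hu) (by rwa [card_map]) (by rwa [card_map])
  rcases (Nat.zero_le (#A * #B)).eq_or_lt with h0 | h0
  · have h2 : edgeCount c i A B = 0 := by
      refine Nat.eq_zero_of_le_zero ((card_filter_le _ _).trans_eq ?_)
      rw [card_product, h0]
    rw [h2, ← Nat.cast_mul, ← h0]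
    simp
  · have h2 : ((colorGraph c i).edgeDensity (A.map Function.Embedding.inl)
        (B.map Function.Embedding.inr) : ℝ) = edgeCount c i A B / (#A * #B) := by
      rw [SimpleGraph.edgeDensity_def, interedges_colorGraph, card_map, card_map]
      push_cast
      rfl
    have h3 : (0 : ℝ) < #A * #B := by exact_mod_cast h0
    rw [h2] at h1
    have h4 := mul_le_mul_of_nonneg_right h1 h3.le
    rwa [← abs_of_pos h3, ← abs_mul, abs_of_pos h3, sub_mul, div_mul_cancel₀ _ h3.ne'] at h4

theorem edgeCount_flip {U V E : Type} [DecidableEq E] (c : U → V → E) (i : E) (A : Finset V)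
    (B : Finset U) : edgeCount (fun v u => c u v) i A B = edgeCount c i B A := by
  refine card_bij (fun e _ => e.swap) ?_ (fun e _ e' _ h => Prod.swap_injective h) ?_
  · intro e he
    rw [mem_filter, mem_product] at he ⊢
    exact ⟨⟨he.1.2, he.1.1⟩, he.2⟩
  · intro e he
    rw [mem_filter, mem_product] at he
    exact ⟨e.swap, by rw [mem_filter, mem_product]; exact ⟨⟨he.1.2, he.1.1⟩, he.2⟩, e.swap_swap⟩

theorem isRegularPair_comm {V : Type} {G : SimpleGraph V} {ε : ℝ} {A B : Finset V}
    (h : IsRegularPair G ε A B) : IsRegularPair G ε B A := by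
  intro B' hB' A' hA' h1 h2
  rw [G.edgeDensity_comm B A, G.edgeDensity_comm B' A']
  exact h A' hA' B' hB' h2 h1

theorem finalColoring_swap (K : Construction s) (b : ℕ) (u v : Side s b) :
    K.swap.finalColoring b u v = K.finalColoring b v u := K.swap_col s u.1 v.1

theorem card_vertex (s b : ℕ) : Fintype.card (Vertex s b) = 2 * Fintype.card (Side s b) := by
  rw [Fintype.card_sum]; ring

/-- The size of a part, as a function on all sets. -/
noncomputable def partCard (Z : Finpartition (univ : Finset (Vertex s b)))
    (z : Finset (Vertex s b)) : ℝ := if z ∈ Z.parts then #z else 0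

theorem card_sides_part (Z : Finpartition (univ : Finset (Vertex s b)))
    (z : Finset (Vertex s b)) :
    (#{u : Side s b | Z.part (Sum.inl u) = z} : ℝ) + #{v : Side s b | Z.part (Sum.inr v) = z} =
      partCard Z z := by
  unfold partCard
  split_ifs with hz
  · rw [← card_toLeft_add_card_toRight (u := z)]
    push_cast
    congr 3
    · ext u
      rw [mem_filter, mem_toLeft, Z.part_eq_iff_mem hz]
      simp
    · ext u
      rw [mem_filter, mem_toRight, Z.part_eq_iff_mem hz]
      simp
  · have h : ∀ x, Z.part x ≠ z := fun x hx => hz (hx ▸ Z.part_mem.2 (mem_univ x))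
    simp [h]

/-- `partCard` is 0 off the partition, so the sum may run over all sets. The factor 2 is there
because the graph has 2N vertices. -/
theorem sum_irregular {G : SimpleGraph (Vertex s b)} {ε : ℝ}
    {Z : Finpartition (univ : Finset (Vertex s b))} (h : IsRegularPartition G ε Z)
    (Irr : Finset (Vertex s b) → Finset (Vertex s b) → Prop)
    (hIrr : ∀ z z', Irr z z' ↔ z ∈ Z.parts ∧ z' ∈ Z.parts ∧ ¬ IsRegularPair G ε z z') :
    ∑ z, ∑ z', (if Irr z z' then partCard Z z * partCard Z z' else 0) ≤
      ε * (2 * Fintype.card (Side s b)) ^ 2 := by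
  have h1 : (Fintype.card (Vertex s b) : ℝ) = 2 * Fintype.card (Side s b) := by
    rw [card_vertex]; push_cast; ring
  rw [← h1]
  refine le_trans (le_of_eq ?_) h
  rw [← Fintype.sum_prod_type', sum_filter, ← sum_subset (subset_univ (Z.parts ×ˢ Z.parts))]
  · refine sum_congr rfl fun x hx => ?_
    rw [mem_product] at hx
    simp only [partCard, hIrr, hx.1, hx.2, true_and, if_true]
  · intro x _ hx
    rw [mem_product, not_and] at hx
    exact if_neg fun h => hx ((hIrr _ _).1 h).1 ((hIrr _ _).1 h).2.1

/-- Both masses are small at the last level. -/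
theorem masses_le (K : Construction s) (hb : 1 ≤ b)
    {N p g : ℝ} (hN : N = Fintype.card (Side s b)) (hp : p = 1 / 2 ^ s) (hg : 0 < g)
    (hg1 : g ≤ 1 / 2 ^ 16) (hsp : s * p ≤ g) (hpg : p ≤ g / 2 ^ 20)
    (new : Side s b → Side s b → (Fin s → Bool))
    (hnew : (#{e : Side s b × Side s b | new e.1 e.2 ≠ K.finalColoring b e.1 e.2} : ℝ) ≤
      g ^ 4 * N ^ 2)
    (Z : Finpartition (univ : Finset (Vertex s b)))
    (I : Finset (Fin s → Bool)) (hI : g ^ 2 ≤ #I * p)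
    (hreg : ∀ i ∈ I, IsRegularPartition (colorGraph new i) (p ^ 5) Z) {R : ℕ} (hR : R ≤ s) :
    mass (fun u : Side s b => Z.part (Sum.inl u)) (128 * g) R ≤ 128 * g * N ∧
      mass (fun v : Side s b => Z.part (Sum.inr v)) (128 * g) R ≤ 128 * g * N := by
  have hN0 : 0 ≤ N := by rw [hN]; positivity
  induction R with
  | zero =>
    rw [mass_zero _ (by positivity), mass_zero _ (by positivity)]
    exact ⟨by positivity, by positivity⟩
  | succ R ih =>
    obtain ⟨ih1, ih2⟩ := ih (by omega)
    obtain ⟨Irr, hIrr⟩ : ∃ Irr : (Fin s → Bool) → Finset (Vertex s b) → Finset (Vertex s b) → Prop,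
        ∀ i z z', Irr i z z' ↔ z ∈ Z.parts ∧ z' ∈ Z.parts ∧
          ¬ IsRegularPair (colorGraph new i) (p ^ 5) z z' := ⟨_, fun _ _ _ => Iff.rfl⟩
    have hIrr' : ∀ i ∈ I, ∑ z, ∑ z', (if Irr i z z' then partCard Z z * partCard Z z' else 0) ≤
        p ^ 5 * (2 * N) ^ 2 := fun i hi => by
      rw [hN]; exact sum_irregular (hreg i hi) (Irr i) (hIrr i)
    have hempty : ∀ (e : Side s b → Vertex s b) (z : Finset (Vertex s b)), z ∉ Z.parts →
        ∀ A : Finset (Side s b), (∀ u ∈ A, Z.part (e u) = z) → A = ∅ := by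
      intro e z hz A hA
      refine eq_empty_of_forall_notMem fun u hu => hz ?_
      rw [← hA u hu]
      exact Z.part_mem.2 (mem_univ _)
    have hmem : ∀ x z, Z.part x = z → x ∈ z := fun x z h => h ▸ Z.mem_part (mem_univ x)
    constructor
    · refine mass_step K hb hN hp hg hg1 hsp hpg new hnew I hI _ _ (partCard Z)
        (fun z => by convert card_sides_part Z z) Irr hIrr' ?_ (by omega) ih2
      intro i _ z z' hzz'
      by_cases hz : z ∈ Z.parts
      · by_cases hz' : z' ∈ Z.parts
        · have hr : IsRegularPair (colorGraph new i) (p ^ 5) z z' := by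
            by_contra h; exact hzz' ((hIrr _ _ _).2 ⟨hz, hz', h⟩)
          refine ⟨_, fun A hA B hB hA' hB' => regular_left hr A B (fun u hu => hmem _ _ (hA u hu))
            (fun v hv => hmem _ _ (hB v hv)) ?_ ?_⟩
          · rwa [partCard, if_pos hz] at hA'
          · rwa [partCard, if_pos hz'] at hB'
        · refine ⟨0, fun A _ B hB _ _ => ?_⟩
          simp [hempty _ z' hz' B hB, edgeCount]
      · refine ⟨0, fun A hA B _ _ _ => ?_⟩
        simp [hempty _ z hz A hA, edgeCount]
    -- The other side is the same step for the construction with its sides exchanged. Both masses at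
    -- level `R` are carried along because each side uses the other's.
    · have hnew' : (#{e : Side s b × Side s b | (fun u v => new v u) e.1 e.2 ≠
          K.swap.finalColoring b e.1 e.2} : ℝ) ≤ g ^ 4 * N ^ 2 := by
        refine le_trans (Nat.cast_le.2 (card_le_card_of_injOn Prod.swap ?_
          Prod.swap_injective.injOn)) hnew
        intro e he
        simp only [coe_filter, mem_univ, true_and, Set.mem_ofPred_eq, finalColoring_swap] at he ⊢
        exact he
      refine mass_step K.swap hb hN hp hg hg1 hsp hpg (fun u v => new v u) hnew' I hI _ _
        (partCard Z) (fun z => by rw [add_comm]; convert card_sides_part Z z) Irr hIrr' ?_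
        (by omega) ih1
      intro i _ z z' hzz'
      by_cases hz : z ∈ Z.parts
      · by_cases hz' : z' ∈ Z.parts
        · have hr : IsRegularPair (colorGraph new i) (p ^ 5) z z' := by
            by_contra h; exact hzz' ((hIrr _ _ _).2 ⟨hz, hz', h⟩)
          refine ⟨((colorGraph new i).edgeDensity z' z : ℝ), fun A hA B hB hA' hB' => ?_⟩
          rw [partCard, if_pos hz] at hA'
          rw [partCard, if_pos hz'] at hB'
          rw [edgeCount_flip, mul_comm (#A : ℝ)]
          exact regular_left (isRegularPair_comm hr) B A (fun u hu => hmem _ _ (hB u hu))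
            (fun v hv => hmem _ _ (hA v hv)) hB' hA'
        · refine ⟨0, fun A _ B hB _ _ => ?_⟩
          simp [hempty _ z' hz' B hB, edgeCount]
      · refine ⟨0, fun A hA B _ _ _ => ?_⟩
        simp [hempty _ z hz A hA, edgeCount]

end

/-! ### From small masses to approximate refinement -/

section

variable {s b : ℕ}

theorem mem_clusters_part {r : ℕ} (h : r ≤ s) (x y : Vertex s b) :
    y ∈ (clusters s b r h).part x ↔ ancestor s b r h x = ancestor s b r h y :=
  Finpartition.mem_part_ofSetoid_iff_rel

theorem ancestor_inl_eq_iff {r : ℕ} (h : r ≤ s) (u : Side s b) (y : Vertex s b) :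
    ancestor s b r h (Function.Embedding.inl u) = ancestor s b r h y ↔
      ∃ v, y = Function.Embedding.inl v ∧ res r h u.1 = res r h v.1 := by
  constructor
  · intro hy
    rcases y with v | v
    · exact ⟨v, rfl, Sum.inl_injective hy⟩
    · exact absurd hy (by simp [ancestor])
  · rintro ⟨v, rfl, hv⟩
    exact congrArg Sum.inl hv

theorem ancestor_inr_eq_iff {r : ℕ} (h : r ≤ s) (u : Side s b) (y : Vertex s b) :
    ancestor s b r h (Function.Embedding.inr u) = ancestor s b r h y ↔
      ∃ v, y = Function.Embedding.inr v ∧ res r h u.1 = res r h v.1 := by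
  constructor
  · intro hy
    rcases y with v | v
    · exact absurd hy (by simp [ancestor])
    · exact ⟨v, rfl, Sum.inr_injective hy⟩
  · rintro ⟨v, rfl, hv⟩
    exact congrArg Sum.inr hv

theorem mem_inf_part (Z P : Finpartition (univ : Finset (Vertex s b))) {S : Finset (Vertex s b)}
    (hS : S ∈ (Z ⊓ P).parts) {x : Vertex s b} (hx : x ∈ S) (y : Vertex s b) :
    y ∈ S ↔ Z.part y = Z.part x ∧ y ∈ P.part x := by
  rw [Finpartition.parts_inf, mem_erase, mem_image] at hS
  obtain ⟨-, ⟨C, D⟩, hCD, rfl⟩ := hS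
  rw [mem_product] at hCD
  simp only [inf_eq_inter, mem_inter] at hx ⊢
  rw [Z.part_eq_of_mem hCD.1 hx.1, P.part_eq_of_mem hCD.2 hx.2, Z.part_eq_iff_mem hCD.1]

/-- A part on one side is contained in a cluster of level `s` up to few elements if this holds
for the greedily chosen cluster. -/
theorem part_nearly_contained (hb : 1 ≤ b) (Z : Finpartition (univ : Finset (Vertex s b)))
    (e : Side s b ↪ Vertex s b)
    (he : ∀ r (h : r ≤ s) u y, ancestor s b r h (e u) = ancestor s b r h y ↔
      ∃ v, y = e v ∧ res r h u.1 = res r h v.1)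
    {γ : ℝ} {S : Finset (Vertex s b)} (hS : S ∈ (Z ⊓ clusters s b 0 (Nat.zero_le s)).parts)
    {u : Side s b} (hu : e u ∈ S)
    (hgood : (1 - γ) * #(piece (fun v => Z.part (e v)) (Z.part (e u), u.1 0)) ≤
      (#(cell (piece (fun v => Z.part (e v)) (Z.part (e u), u.1 0)) s
        (greedy (fun v => Z.part (e v)) (Z.part (e u), u.1 0))) : ℝ)) :
    ∃ T ∈ (clusters s b s le_rfl).parts, (#(S \ T) : ℝ) ≤ γ * #S := by
  set Q := piece (fun v => Z.part (e v)) (Z.part (e u), u.1 0) with hQ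
  set x := greedy (fun v => Z.part (e v)) (Z.part (e u), u.1 0) with hx
  have hSQ : S = Q.map e := by
    ext y
    rw [mem_inf_part _ _ hS hu, mem_clusters_part, he, mem_map]
    constructor
    · rintro ⟨h1, v, rfl, h2⟩
      exact ⟨v, mem_piece.2 ⟨h1, (congrFun h2 0).symm⟩, rfl⟩
    · rintro ⟨v, hv, rfl⟩
      rw [hQ, mem_piece] at hv
      refine ⟨hv.1, v, rfl, funext fun k => ?_⟩
      obtain rfl : k = 0 := Fin.ext (Nat.lt_one_iff.1 k.2)
      exact hv.2.symm
  refine ⟨(clusters s b s le_rfl).part (e (x, ⟨0, hb⟩)),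
    (Finpartition.part_mem _).2 (mem_univ _), ?_⟩
  have hsub : S \ (clusters s b s le_rfl).part (e (x, ⟨0, hb⟩)) ⊆ (Q \ cell Q s x).map e := by
    intro y hy
    rw [mem_sdiff, mem_clusters_part, he, hSQ, mem_map] at hy
    obtain ⟨⟨v, hv, rfl⟩, h2⟩ := hy
    refine mem_map_of_mem _ (mem_sdiff.2 ⟨hv, fun hc => h2 ⟨v, rfl, ?_⟩⟩)
    exact ((agree_iff_res le_rfl _ _).1 (mem_cell.1 hc).2).symm
  have h1 : (#(S \ (clusters s b s le_rfl).part (e (x, ⟨0, hb⟩))) : ℝ) ≤ #(Q \ cell Q s x) := by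
    rw [← card_map e]
    exact_mod_cast card_le_card hsub
  rw [cast_card_sdiff (cell_subset _ _ _)] at h1
  have h2 : #S = #Q := by rw [hSQ, card_map]
  rw [h2]
  linarith

theorem card_bad_eq_mass {ι : Type} [Fintype ι] (ζ : Side s b → ι) (γ : ℝ) (r : ℕ) :
    (#{u : Side s b | (#(cell (piece ζ (ζ u, u.1 0)) r (greedy ζ (ζ u, u.1 0))) : ℝ) <
      (1 - γ) * #(piece ζ (ζ u, u.1 0))} : ℝ) = mass ζ γ r := by
  rw [mass, ← Nat.cast_sum, Nat.cast_inj, ← card_biUnion fun q _ q' _ h => piece_disjoint ζ h]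
  congr 1
  ext u
  simp only [mem_filter, mem_univ, true_and, mem_biUnion]
  constructor
  · intro h
    exact ⟨_, h, mem_piece_self ζ u⟩
  · rintro ⟨q, h, hu⟩
    rw [mem_piece] at hu
    obtain rfl : (ζ u, u.1 0) = q := Prod.ext hu.1 hu.2
    exact h

/-- Every part of Z ∩ X₀ is a piece on one side, because clusters of level 0 do not meet both sides.
The violating parts therefore lie in the two bad sets counted by the masses, and γN + γN = γ·2N. -/
theorem approxRefines_of_masses (hb : 1 ≤ b) (Z : Finpartition (univ : Finset (Vertex s b)))
    {γ : ℝ}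
    (h1 : mass (fun u : Side s b => Z.part (Sum.inl u)) γ s ≤ γ * Fintype.card (Side s b))
    (h2 : mass (fun u : Side s b => Z.part (Sum.inr u)) γ s ≤ γ * Fintype.card (Side s b)) :
    ApproxRefines γ (Z ⊓ clusters s b 0 (Nat.zero_le s)) (clusters s b s le_rfl) := by
  unfold ApproxRefines
  rw [card_vertex]
  rw [← card_bad_eq_mass] at h1 h2
  set Q := Z ⊓ clusters s b 0 (Nat.zero_le s) with hQ
  set bad : (Side s b → Finset (Vertex s b)) → Finset (Side s b) := fun ζ =>
    {u : Side s b | (#(cell (piece ζ (ζ u, u.1 0)) s (greedy ζ (ζ u, u.1 0))) : ℝ) <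
      (1 - γ) * #(piece ζ (ζ u, u.1 0))} with hbad
  have hsub : (Q.parts.filter fun S => ¬ ∃ T ∈ (clusters s b s le_rfl).parts,
      (#(S \ T) : ℝ) ≤ γ * #S).biUnion id ⊆
      (bad fun u => Z.part (Sum.inl u)).map Function.Embedding.inl ∪
        (bad fun u => Z.part (Sum.inr u)).map Function.Embedding.inr := by
    intro y hy
    rw [mem_biUnion] at hy
    obtain ⟨S, hS, hyS⟩ := hy
    rw [mem_filter] at hS
    rw [mem_union, mem_map, mem_map]
    rcases y with u | u
    · refine Or.inl ⟨u, ?_, rfl⟩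
      rw [hbad, mem_filter]
      refine ⟨mem_univ _, ?_⟩
      by_contra hcon
      exact hS.2 (part_nearly_contained hb Z Function.Embedding.inl
        (fun r h => ancestor_inl_eq_iff h) hS.1 hyS (not_lt.1 hcon))
    · refine Or.inr ⟨u, ?_, rfl⟩
      rw [hbad, mem_filter]
      refine ⟨mem_univ _, ?_⟩
      by_contra hcon
      exact hS.2 (part_nearly_contained hb Z Function.Embedding.inr
        (fun r h => ancestor_inr_eq_iff h) hS.1 hyS (not_lt.1 hcon))
  have h3 := (card_le_card hsub).trans (card_union_le _ _)
  rw [card_map, card_map, card_biUnion fun S hS S' hS' h =>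
    Q.disjoint (mem_of_mem_filter _ hS) (mem_of_mem_filter _ hS') h] at h3
  have h4 : (∑ S ∈ Q.parts with ¬ ∃ T ∈ (clusters s b s le_rfl).parts,
      (#(S \ T) : ℝ) ≤ γ * #S, (#S : ℝ)) ≤ #(bad fun u => Z.part (Sum.inl u)) +
      #(bad fun u => Z.part (Sum.inr u)) := by
    exact_mod_cast h3
  refine h4.trans ((add_le_add h1 h2).trans_eq ?_)
  push_cast
  ring

/-! ### The tower bound -/

/-- The summand 20 gives the induction room: the exponent n_r/200 is at least twr r + 20, and the
factor 2^20 pays for the next 200 and the next summand. -/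
theorem twr_le_partSize (s r : ℕ) : 200 * (twr r + 20) ≤ partSize s r := by
  induction r with
  | zero =>
    rw [partSize_zero, twr]
    calc 200 * (1 + 20) ≤ 4 ^ 8 := by norm_num
      _ ≤ 4 ^ (s + 8) := Nat.pow_le_pow_right (by norm_num) (by omega)
  | succ r ih =>
    have h1 : twr r + 20 ≤ partSize s r / 200 := by omega
    have h2 : 2 ^ (twr r + 20) ≤ partSize s (r + 1) := Nat.pow_le_pow_right (by norm_num) h1
    have h3 : 1 ≤ 2 ^ twr r := Nat.one_le_two_pow
    rw [twr]
    rw [pow_add] at h2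
    omega

theorem card_parts_inf_le {V : Type} [Fintype V] [DecidableEq V]
    (P Q : Finpartition (univ : Finset V)) : #(P ⊓ Q).parts ≤ #P.parts * #Q.parts := by
  rw [Finpartition.parts_inf, ← card_product]
  exact (card_erase_le).trans card_image_le

theorem card_clusters_le {r : ℕ} (h : r ≤ s) :
    #(clusters s b r h).parts ≤ 2 * Fintype.card (Vtx s r) := by
  have h1 : (clusters s b r h).parts ⊆ (univ : Finset (Vtx s r ⊕ Vtx s r)).image
      fun a => univ.filter fun y : Vertex s b => a = ancestor s b r h y := by
    intro T hT
    obtain ⟨x, hx⟩ := (clusters s b r h).nonempty_of_mem_parts hT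
    refine mem_image.2 ⟨ancestor s b r h x, mem_univ _, ?_⟩
    rw [← (clusters s b r h).part_eq_of_mem hT hx]
    ext y
    rw [mem_clusters_part, mem_filter]
    simp
  refine (card_le_card h1).trans (card_image_le.trans_eq ?_)
  rw [card_univ, Fintype.card_sum]
  ring

theorem card_cluster_last_le {T : Finset (Vertex s b)} (hT : T ∈ (clusters s b s le_rfl).parts) :
    #T ≤ b := by
  obtain ⟨x, hx⟩ := (clusters s b s le_rfl).nonempty_of_mem_parts hT
  rw [← (clusters s b s le_rfl).part_eq_of_mem hT hx]
  refine (card_le_card_of_injOn (t := (univ : Finset (Fin b)))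
    (Sum.elim (fun u : Side s b => u.2) fun u => u.2) (fun _ _ => mem_coe.2 (mem_univ _))
    ?_).trans_eq (by simp)
  intro y hy y' hy' h
  rw [mem_coe, mem_clusters_part] at hy hy'
  have h2 := hy.symm.trans hy'
  rcases y with u | u
  · obtain ⟨v, rfl, hv⟩ := (ancestor_inl_eq_iff le_rfl u y').1 h2
    exact congrArg Sum.inl (Prod.ext hv h)
  · obtain ⟨v, rfl, hv⟩ := (ancestor_inr_eq_iff le_rfl u y').1 h2
    exact congrArg Sum.inr (Prod.ext hv h)

theorem twr_le_card_parts (hs : 1 ≤ s) (hb : 1 ≤ b)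
    (Z : Finpartition (univ : Finset (Vertex s b))) {γ : ℝ} (hγ : γ ≤ 1 / 4)
    (h : ApproxRefines γ (Z ⊓ clusters s b 0 (Nat.zero_le s)) (clusters s b s le_rfl)) :
    twr s ≤ #Z.parts := by
  unfold ApproxRefines at h
  set Q := Z ⊓ clusters s b 0 (Nat.zero_le s) with hQ
  have htot : ∑ S ∈ Q.parts, (#S : ℝ) = 2 * Fintype.card (Vtx s s) * b := by
    rw [← Nat.cast_sum, Q.sum_card_parts, card_univ, card_vertex, card_side]
    push_cast
    ring
  have hcardV : (Fintype.card (Vertex s b) : ℝ) = 2 * Fintype.card (Vtx s s) * b := by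
    rw [card_vertex, card_side]
    push_cast
    ring
  rw [← sum_filter_add_sum_filter_not Q.parts
    (fun S => ∃ T ∈ (clusters s b s le_rfl).parts, (#(S \ T) : ℝ) ≤ γ * #S)] at htot
  have hb0 : (0 : ℝ) < b := by exact_mod_cast hb
  have hgood : ∑ S ∈ Q.parts with ∃ T ∈ (clusters s b s le_rfl).parts,
      (#(S \ T) : ℝ) ≤ γ * #S, (#S : ℝ) ≤ #Q.parts * (2 * b) := by
    refine (sum_le_card_nsmul _ _ (2 * b : ℝ) fun S hS => ?_).trans ?_
    · obtain ⟨T, hT, hST⟩ := (mem_filter.1 hS).2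
      have h1 : (#T : ℝ) ≤ b := by exact_mod_cast card_cluster_last_le hT
      have h2 : (#S : ℝ) ≤ #(S \ T) + #T := by
        have : #S ≤ #(S \ T) + #T := by
          rw [← card_sdiff_add_card_inter S T]
          exact Nat.add_le_add_left (card_le_card inter_subset_right) _
        exact_mod_cast this
      -- A part with at least three quarters of its elements in a cluster of at most `b` vertices
      -- has at most 4b/3 ≤ 2b elements.
      have h3 : γ * #S ≤ 1 / 4 * (#S : ℝ) := by gcongr
      linarith
    · rw [nsmul_eq_mul]
      gcongr
      exact filter_subset _ _
  have h5 : γ * (Fintype.card (Vertex s b) : ℝ) ≤ 1 / 4 * Fintype.card (Vertex s b) := by gcongr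
  rw [hcardV] at h h5
  have h6 : 3 / 4 * (2 * Fintype.card (Vtx s s) * b : ℝ) ≤ #Q.parts * (2 * b) := by linarith
  have h7 : (Fintype.card (Vtx s s) : ℝ) ≤ 2 * #Q.parts := by
    refine le_of_mul_le_mul_right ?_ hb0
    have : 0 ≤ (Fintype.card (Vtx s s) : ℝ) * b := by positivity
    linarith
  have h8 : Fintype.card (Vtx s s) ≤ 2 * #Q.parts := by exact_mod_cast h7
  have h9 : #Q.parts ≤ #Z.parts * (2 * partSize s 0) := by
    refine (card_parts_inf_le _ _).trans (Nat.mul_le_mul_left _ ((card_clusters_le _).trans_eq ?_))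
    rw [card_vtx]
    simp
  -- The factor n₀ cancels against the number 2n₀ of clusters of level 0, leaving n_s ≤ 4|Z|.
  have h10 : partSize s 0 * partSize s s ≤ Fintype.card (Vtx s s) := by
    obtain ⟨t, rfl⟩ : ∃ t, s = t + 1 := ⟨s - 1, by omega⟩
    rw [card_vtx_succ]
    refine Nat.mul_le_mul_right _ ?_
    rw [card_vtx, prod_range_succ']
    exact Nat.le_mul_of_pos_left _ (prod_pos fun i _ => partSize_pos _ _)
  have h11 : partSize s 0 * partSize s s ≤ partSize s 0 * (4 * #Z.parts) := by
    calc _ ≤ _ := h10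
      _ ≤ _ := h8
      _ ≤ 2 * (#Z.parts * (2 * partSize s 0)) := Nat.mul_le_mul_left _ h9
      _ = _ := by ring
  have h12 := Nat.le_of_mul_le_mul_left h11 (partSize_pos s 0)
  have h13 := twr_le_partSize s s
  omega

end

end SparseReg

/-! ### Choice of parameters and conclusion -/

theorem mainTheorem9 :
    ∃ c : ℝ, 0 < c ∧
      ∀ (s : ℕ) (_ : Even s) (_ : 400 ≤ s) (K : SparseReg.Construction s)
        (b : ℕ) (_ : 1 ≤ b) (N : ℕ) (_ : N = Fintype.card (SparseReg.Side s b))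
        (p : ℝ) (_ : p = 1 / 2 ^ s)
        (δ : ℝ) (_ : p ^ (4 / 7 : ℝ) ≤ δ) (_ : δ ≤ 1 / 2 ^ 66)
        (Z : Finpartition (Finset.univ : Finset (SparseReg.Vertex s b)))
        (newColoring : SparseReg.Side s b → SparseReg.Side s b → (Fin s → Bool))
        (_ : (#{e : SparseReg.Side s b × SparseReg.Side s b |
            newColoring e.1 e.2 ≠ K.finalColoring b e.1 e.2} : ℝ) ≤ δ * (N : ℝ) ^ 2)
        (_ : √δ * 2 ^ s ≤ (#{i : Fin s → Bool | SparseReg.IsRegularPartition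
            (SparseReg.colorGraph newColoring i) (p ^ 5) Z} : ℝ)),
        SparseReg.ApproxRefines (128 * δ ^ (1 / 4 : ℝ))
            (Z ⊓ SparseReg.clusters s b 0 (Nat.zero_le s)) (SparseReg.clusters s b s le_rfl) ∧
          SparseReg.twr ⌊c * Real.logb 2 (1 / p)⌋₊ ≤ #Z.parts := by
  -- c = 1 works: log₂(1/p) = s, and the tower obtained has height s.
  refine ⟨1, one_pos, ?_⟩
  intro s hs hs400 K b hb N hN p hp δ hδ1 hδ2 Z new hnew hI
  -- Evenness of s makes ρ = √p = 2^(-s/2) a power of 1/2 with an integer exponent.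
  obtain ⟨h, hh⟩ := hs
  set ρ : ℝ := 1 / 2 ^ h with hρ
  have hρ0 : 0 < ρ := by positivity
  have hpρ : p = ρ ^ 2 := by
    rw [hp, hρ, hh, one_div_pow, ← pow_mul, mul_two]
  have hp0 : 0 < p := by rw [hpρ]; positivity
  have hρsmall : ρ ≤ 1 / 2 ^ 20 :=
    one_div_le_one_div_of_le (by positivity) (pow_le_pow_right₀ (by norm_num) (by omega))
  have hρ1 : ρ ≤ 1 := hρsmall.trans (by norm_num)
  have hp1 : p ≤ 1 := by rw [hpρ]; exact pow_le_one₀ hρ0.le hρ1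
  have hδ0 : 0 < δ := lt_of_lt_of_le (by positivity) hδ1
  set g : ℝ := δ ^ (1 / 4 : ℝ) with hg
  have hg0 : 0 < g := by positivity
  have hg4 : g ^ 4 = δ := by
    rw [hg, ← Real.rpow_natCast, ← Real.rpow_mul hδ0.le]
    norm_num
  -- This is p² ≤ δ, which follows from p^{4/7} ≤ δ. Together with sρ ≤ 1 and ρ ≤ 2^(-20) it gives
  -- both sp ≤ g and p ≤ g/2^20.
  have hρg : ρ ≤ g := by
    refine le_of_pow_le_pow_left₀ (n := 4) (by norm_num) hg0.le ?_
    rw [hg4]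
    refine le_trans ?_ hδ1
    have h1 : ρ ^ 4 = p ^ (2 : ℝ) := by
      rw [Real.rpow_two, hpρ]; ring
    rw [h1]
    exact Real.rpow_le_rpow_of_exponent_ge hp0 hp1 (by norm_num)
  have hg1 : g ≤ 1 / 2 ^ 16 := by
    refine le_of_pow_le_pow_left₀ (n := 4) (by norm_num) (by positivity) ?_
    rw [hg4]
    exact hδ2.trans (by norm_num)
  have hsρ : (s : ℝ) * ρ ≤ 1 := by
    rw [hρ, mul_one_div]
    refine div_le_one_of_le₀ ?_ (by positivity)
    have h1 : ∀ k : ℕ, 3 ≤ k → 2 * k ≤ 2 ^ k := by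
      intro k hk
      induction k, hk using Nat.le_induction with
      | base => norm_num
      | succ k hk ih => rw [pow_succ]; omega
    have h2 := h1 h (by omega)
    have h3 : s ≤ 2 ^ h := by omega
    exact_mod_cast h3
  have hsp : (s : ℝ) * p ≤ g := by
    have h1 : (s : ℝ) * p = (s * ρ) * ρ := by rw [hpρ]; ring
    rw [h1]
    have := mul_le_mul_of_nonneg_right hsρ hρ0.le
    linarith
  have hpg : p ≤ g / 2 ^ 20 := by
    have h1 : p = ρ * ρ := by rw [hpρ]; ring
    rw [h1]
    have h2 : ρ * ρ ≤ g * (1 / 2 ^ 20) := mul_le_mul hρg hρsmall hρ0.le hg0.le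
    rw [div_eq_mul_one_div]
    exact h2
  have hsqrt : √δ = g ^ 2 := by
    rw [← hg4, show g ^ 4 = (g ^ 2) ^ 2 by ring, Real.sqrt_sq (by positivity)]
  have hmass := SparseReg.masses_le K hb (N := (N : ℝ)) (by rw [hN]) hp hg0 hg1 hsp hpg new
    (by rw [hg4]; exact hnew) Z
    (univ.filter fun i => SparseReg.IsRegularPartition (SparseReg.colorGraph new i) (p ^ 5) Z)
    (by
      rw [hsqrt] at hI
      rw [hp, mul_one_div, le_div_iff₀ (by positivity), ← hp]
      exact hI)
    (fun i hi => (mem_filter.1 hi).2) le_rfl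
  rw [hN] at hmass
  have hmain := SparseReg.approxRefines_of_masses hb Z hmass.1 hmass.2
  refine ⟨hmain, ?_⟩
  have hfloor : ⌊(1 : ℝ) * Real.logb 2 (1 / p)⌋₊ = s := by
    rw [hp, one_mul, one_div_one_div, Real.logb_pow, Real.logb_self_eq_one (by norm_num), mul_one,
      Nat.floor_natCast]
  rw [hfloor]
  refine SparseReg.twr_le_card_parts (by omega) hb Z ?_ hmain
  have := mul_le_mul_of_nonneg_left hg1 (show (0 : ℝ) ≤ 128 by norm_num)
  linarith
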